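/- **Setting.** Let $G=(V,E)$ be a finite connected undirected graph with edge weights $w>0$ and shortest-path distance $d_G$. There are $N\ge 1$ robots and $M$ tasks, and $f_i^j:\mathbb R\to\mathbb R$ is strictly increasing for each robot $i$ and task $j$. For a demand $\Phi=(\phi^j(v))_{v\in V,\,j\le M}$, a configuration $\eta\in V^N$ and coverings $P=(P_i^j)$ of $V$ ($\bigcup_i P_i^j=V$ for all $j$), put $$\mathcal H(\eta,P)=\sum_{j}\sum_{i}\sum_{v\in P_i^j} f_i^j(d_G(\eta_i,v))\,\phi^j(v),\qquad \mathcal H_{\inf}(\eta,\Phi)=\sum_j\sum_{v\in V}\Big(\min_{i} f_i^j(d_G(\eta_i,v))\Big)\phi^j(v).$$ Multitask centers $c(P)$ satisfy $c_i(P)\in\arg\min_{x\in V}\sum_j\sum_{v\in P_i^j}f_i^j(d_G(x,v))\phi^j(v)$. Fix a tie-breaking rule which chooses, for all $\eta,j,v$, one robot $b(\eta,j,v)\in\arg\min_i f_i^j(d_G(\eta_i,v))$. The equitable partitions are $\mathcal V(\eta)_i^j=\{v: b(\eta,j,v)=i\}$. The instantaneous regret of $(\eta_t,P_t)$ is $$\mathcal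 R_t(\Phi)=2\mathcal H(\eta_t,P_t)-\mathcal H(c(P_t),P_t)-\mathcal H(\eta_t,\mathcal V(\eta_t)).$$ **Demand and samples.** The vertices have positions in a compact convex set $D\subset\mathbb R^2$. The demand has the prior $\Phi\sim\mathcal N(\tilde\mu_0,\Sigma_0\otimes K)$, where $\Sigma_0$ is the squared-exponential covariance $k(v,v')=\sigma_v^2\exp(-d_{\rm eu}(v,v')^2/(2\lambda^2))$, $\sigma_v,\lambda>0$, and $K$ is positive semidefinite. The $k$-th sample, taken at $v_{s_k}$, is $y_k=\Phi(v_{s_k})+\epsilon_k$ with $\epsilon_k\sim\mathcal N(0,\sigma^2I_M)$, $\sigma>0$, independent of each other and of $\Phi$. $\tilde\mu(k)$ and $\tilde\Sigma(k)$ denote the Gaussian posterior mean and covariance after $k$ samples, and $\tilde\Sigma_v(k)$ the $M\times M$ diagonal block of $\tilde\Sigma(k)$ at $v$. The sampling points are greedy: $s_{k+1}\in\arg\max_{v}\det(I_M+\sigma^{-2}\tilde\Sigma_v(k))$. Let $\tau$ satisfy $\operatorname{tr}\tilde\Sigma_v(0)\le\tau$ for all $v$. **Communication.** Time is slotted. In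 each slot at most one robot communicates with the base station, and for each robot the time between consecutive communications is at least $l>0$ and at most $u>l$. **DSMLC.** Parameters $\beta>1$ and $\alpha\in(0,1)$. Epoch $\ell=1,2,\dots$ consists of three phases. 1. *Exploration.* Greedy sampling points are added until $\max_v\operatorname{tr}\tilde\Sigma_v(k)\le\alpha^\ell\tau$. Each new point is assigned to a robot whose current multitask center (for the current estimate; the prior mean in the first epoch) is nearest, and is visited by that robot; the phase lasts at most $\rho$ slots per new sampling point, for a constant $\rho$. 2. *Information propagation.* This lasts until every robot has communicated; then $\hat\Phi=\tilde\mu$. 3. *Coverage*, for $\lceil\beta^\ell\rceil$ slots. If robot $i$ communicates in the slot and $\mathcal H_{\inf}(\cdot,\hat\Phi)$ can be strictly decreased by changing $\eta_i$ alone, then $\eta_i$ is moved to a minimizer; afterwards, for each $j$, $P_i^j\leftarrow(P_i^j\setminus P_{i,-}^j)\cup P_{i,+}^j$, where $P_{i,+}^j=\{v:b(\eta,j,v)=i\}$ and $P_{i,-}^j=\{v\in P_i^j\cap\bigcup_{i'\ne i}P_{i'}^j:\ b(\eta,j,v)\ne i\}$. If no robot communicates, nothing changes. The coverings are unchanged in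 phases 1 and 2; the initial one is arbitrary. **Theorem.** If $\alpha=\beta^{-2/3}$, then, in expectation given that the demand is nonnegative, the cumulative multitask coverage regret of DSMLC is integrable for every horizon $T$ and satisfies, as $T\to\infty$, $$\mathbb E\Big[\sum_{t=1}^T\mathcal R_t(\Phi)\ \Big|\ \phi^j(v)\ge 0\ \text{ for all } v,j\Big]\in O\big(T^{2/3}(\log T)^3\big).$$ -/

import Mathlib

namespace MultitaskCoverage

noncomputable section

open scoped Kronecker

/-- A weighted connected graph environment on the vertex set `V`, with `N` robots and `M` tasks.
`f i j` is the (strictly increasing) service cost of robot `i` on task `j` as a function of the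
graph distance. -/
structure Environment (V : Type*) (N M : ℕ) where
  G : SimpleGraph V
  connected : G.Connected
  w : Sym2 V → ℝ
  w_pos : ∀ e ∈ G.edgeSet, 0 < w e
  f : Fin N → Fin M → ℝ → ℝ
  f_strictMono : ∀ i j, StrictMono (f i j)

/-- Demand functions `φ^j(v)`, written `Φ v j`. -/
abbrev Demand (V : Type*) (M : ℕ) := V → Fin M → ℝ

/-- Robot team configurations `η`. -/
abbrev Config (V : Type*) (N : ℕ) := Fin N → V

/-- Collections of sets `P j i` (vertices at which robot `i` services task `j`). -/
abbrev Coverings (V : Type*) (N M : ℕ) := Fin M → Fin N → Finset V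

/-- Each `P j` is an `N`-covering of `V`. -/
def IsCovering {V : Type*} {N M : ℕ} (P : Coverings V N M) : Prop :=
  ∀ j v, ∃ i, v ∈ P j i

namespace Environment

variable {V : Type*} {N M : ℕ}

/-- Weighted graph distance: the minimal total weight of a walk. -/
def gdist (env : Environment V N M) (u v : V) : ℝ :=
  ⨅ p : env.G.Walk u v, (p.edges.map env.w).sum

/-- Cost of servicing task `j` at `v` by robot `i` located at `x`. -/
def service (env : Environment V N M) (i : Fin N) (j : Fin M) (x v : V) : ℝ :=
  env.f i j (env.gdist x v)

/-- Multitask coverage cost. -/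
def cost (env : Environment V N M) (Φ : Demand V M) (η : Config V N) (P : Coverings V N M) : ℝ :=
  ∑ j, ∑ i, ∑ v ∈ P j i, env.service i j (η i) v * Φ v j

/-- The part of the coverage cost incurred by robot `i` when it sits at `c`. -/
def robotCost (env : Environment V N M) (Φ : Demand V M) (P : Coverings V N M) (i : Fin N)
    (c : V) : ℝ :=
  ∑ j, ∑ v ∈ P j i, env.service i j c v * Φ v j

/-- `c` is a vector of multitask centers of `P` for the demand `Φ`. -/
def IsCenters (env : Environment V N M) (Φ : Demand V M) (P : Coverings V N M)
    (c : Config V N) : Prop :=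
  ∀ i x, env.robotCost Φ P i (c i) ≤ env.robotCost Φ P i x

theorem exists_isCenters [Finite V] (env : Environment V N M) (Φ : Demand V M) (P : Coverings V N M) :
    ∃ c, env.IsCenters Φ P c := by
  have := env.connected.nonempty
  choose c hc using fun i => Finite.exists_min (env.robotCost Φ P i)
  exact ⟨c, hc⟩

/-- Multitask centers `c(P)` (some choice of them; the cost at the centers does not depend on the
choice). -/
def centers [Finite V] (env : Environment V N M) (Φ : Demand V M) (P : Coverings V N M) : Config V N :=
  (env.exists_isCenters Φ P).choose

variable [Fintype V]

/-- The cost `H_inf`: every task at every vertex is serviced by a best robot. -/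
def costInf (env : Environment V N M) (Φ : Demand V M) (η : Config V N) : ℝ :=
  ∑ j, ∑ v, (⨅ i, env.service i j (η i) v) * Φ v j

/-- A tie-breaking rule: for each configuration, task and vertex it names one robot among those
with the smallest service cost. -/
structure TieBreak (env : Environment V N M) where
  best : Config V N → Fin M → V → Fin N
  best_le : ∀ η j v i,
    env.service (best η j v) j (η (best η j v)) v ≤ env.service i j (η i) v

/-- Multitask equitable partitions of `η`, with ties broken by `tb`. -/
def equitable {env : Environment V N M} (tb : env.TieBreak) (η : Config V N) :
    Coverings V N M :=
  fun j i => {v | tb.best η j v = i}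

/-- Instantaneous multitask coverage regret
`2 H(η, P) - H(c(P), P) - H(η, 𝒱(η))` for the demand `Φ`. -/
def regret {env : Environment V N M} (tb : env.TieBreak) (Φ : Demand V M) (η : Config V N)
    (P : Coverings V N M) : ℝ :=
  2 * env.cost Φ η P - env.cost Φ (env.centers Φ P) P - env.cost Φ η (equitable tb η)

variable [DecidableEq V]

/-- The vertices that robot `i` gains for task `j`: those best served by robot `i` at `η`. When no
other robot ties with the best one, this says that the service cost of `i` is strictly smaller
than that of every other robot. -/
def gain {env : Environment V N M} (tb : env.TieBreak) (η : Config V N) (j : Fin M) (i : Fin N) :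
    Finset V :=
  {v | tb.best η j v = i}

/-- The vertices that robot `i` drops for task `j`: those also owned by another robot and not best
served by robot `i`. -/
def loss {env : Environment V N M} (tb : env.TieBreak) (η : Config V N) (P : Coverings V N M)
    (j : Fin M) (i : Fin N) : Finset V :=
  {v ∈ P j i | (∃ i', i' ≠ i ∧ v ∈ P j i') ∧ tb.best η j v ≠ i}

/-- One call of the federated multitask coverage algorithm with demand `Φ`, for the robot `i` that
communicates with the base station: `η i` is moved to a minimizer of `H_inf` over the position of
robot `i`, but only if this strictly decreases `H_inf`; then the sets of robot `i` are updated. -/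
def FMCUpdate {env : Environment V N M} (tb : env.TieBreak) (Φ : Demand V M) (i : Fin N)
    (η : Config V N) (P : Coverings V N M) (η' : Config V N) (P' : Coverings V N M) : Prop :=
  (∃ x : V, η' = Function.update η i x ∧
    (∀ v, env.costInf Φ (Function.update η i x) ≤ env.costInf Φ (Function.update η i v)) ∧
    (env.costInf Φ η ≤ env.costInf Φ (Function.update η i x) → x = η i)) ∧
  ∀ j, P' j = Function.update (P j) i ((P j i \ loss tb η' P j i) ∪ gain tb η' j i)

/-- One time slot of the coverage phase: if a robot communicates, the base station runs the
coverage algorithm for it; otherwise nothing changes. -/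
def FMCStep {env : Environment V N M} (tb : env.TieBreak) (Φ : Demand V M)
    (comm : Option (Fin N)) (η : Config V N) (P : Coverings V N M) (η' : Config V N)
    (P' : Coverings V N M) : Prop :=
  (comm = none → η' = η ∧ P' = P) ∧ ∀ i, comm = some i → FMCUpdate tb Φ i η P η' P'

end Environment

/-- Federated communication: `comm t` is the robot (at most one) that communicates with the base
station in slot `t`; for every robot the time between consecutive communications is at least `l`
and at most `u`. -/
structure IsFederated {N : ℕ} (l u : ℕ) (comm : ℕ → Option (Fin N)) : Prop where
  l_pos : 0 < l
  l_lt_u : l < u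
  gap_ge : ∀ i t t', t < t' → comm t = some i → comm t' = some i → l ≤ t' - t
  gap_le : ∀ i t, ∃ t', t < t' ∧ t' ≤ t + u ∧ comm t' = some i

section Estimation

variable {V : Type*} [Fintype V] [DecidableEq V] {M : ℕ}

/-- Squared-exponential covariance of vertices at positions `pos` in the plane. -/
def seKernel (pos : V → EuclideanSpace ℝ (Fin 2)) (σv len : ℝ) : Matrix V V ℝ :=
  Matrix.of fun v v' => σv ^ 2 * Real.exp (-(dist (pos v) (pos v') ^ 2 / (2 * len ^ 2)))

/-- Number of the first `k` samples that are taken at `v`. -/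
def sampleCount (s : ℕ → V) (k : ℕ) (v : V) : ℕ :=
  ((Finset.range k).filter fun m => s m = v).card

/-- The precision `∑ᵥ (nᵥ / σ²) eᵥ eᵥᵀ ⊗ I_M` contributed by the first `k` samples. -/
def samplePrecision (M : ℕ) (σ : ℝ) (s : ℕ → V) (k : ℕ) :
    Matrix (V × Fin M) (V × Fin M) ℝ :=
  (Matrix.diagonal fun v => (sampleCount s k v : ℝ) / σ ^ 2) ⊗ₖ (1 : Matrix (Fin M) (Fin M) ℝ)

/-- Posterior covariance after the first `k` samples of the prior covariance `S`. The form
`(1 + S D)⁻¹ S` of `(S⁻¹ + D)⁻¹` also makes sense for a singular `S`. -/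
def postCov (S : Matrix (V × Fin M) (V × Fin M) ℝ) (σ : ℝ) (s : ℕ → V) (k : ℕ) :
    Matrix (V × Fin M) (V × Fin M) ℝ :=
  (1 + S * samplePrecision M σ s k)⁻¹ * S

/-- The vector `∑ᵥ eᵥ ⊗ (sum of the samples at v) / σ²` for the first `k` samples. -/
def sampleSum (σ : ℝ) (s : ℕ → V) (y : ℕ → Fin M → ℝ) (k : ℕ) : V × Fin M → ℝ :=
  fun p => (∑ m ∈ (Finset.range k).filter (fun m => s m = p.1), y m p.2) / σ ^ 2

/-- Posterior mean after the first `k` samples `y 0, …, y (k - 1)`, taken at `s 0, …, s (k - 1)`,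
for the prior mean `μ₀` and prior covariance `S`. -/
def postMean (μ₀ : V × Fin M → ℝ) (S : Matrix (V × Fin M) (V × Fin M) ℝ) (σ : ℝ) (s : ℕ → V)
    (y : ℕ → Fin M → ℝ) (k : ℕ) : V × Fin M → ℝ :=
  (1 + S * samplePrecision M σ s k)⁻¹.mulVec (μ₀ + S.mulVec (sampleSum σ s y k))

theorem postCov_eq (S : Matrix (V × Fin M) (V × Fin M) ℝ) (hS : IsUnit S.det) (σ : ℝ)
    (s : ℕ → V) (k : ℕ) : postCov S σ s k = (S⁻¹ + samplePrecision M σ s k)⁻¹ := by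
  have h : S⁻¹ + samplePrecision M σ s k = S⁻¹ * (1 + S * samplePrecision M σ s k) := by
    rw [mul_add, mul_one, ← mul_assoc, Matrix.nonsing_inv_mul S hS, one_mul]
  rw [h, Matrix.mul_inv_rev, Matrix.nonsing_inv_nonsing_inv S hS, postCov]

theorem postMean_eq (μ₀ : V × Fin M → ℝ) (S : Matrix (V × Fin M) (V × Fin M) ℝ)
    (hS : IsUnit S.det) (σ : ℝ) (s : ℕ → V) (y : ℕ → Fin M → ℝ) (k : ℕ) :
    postMean μ₀ S σ s y k =
      (postCov S σ s k).mulVec (S⁻¹.mulVec μ₀ + sampleSum σ s y k) := by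
  rw [postMean, postCov, ← Matrix.mulVec_mulVec, Matrix.mulVec_add S, Matrix.mulVec_mulVec,
    Matrix.mul_nonsing_inv S hS, Matrix.one_mulVec]

/-- The `M × M` diagonal block of a covariance matrix at the vertex `v`. -/
def block (C : Matrix (V × Fin M) (V × Fin M) ℝ) (v : V) : Matrix (Fin M) (Fin M) ℝ :=
  C.submatrix (fun j => (v, j)) (fun j => (v, j))

/-- `s` is a greedy sampling sequence: each sample maximizes the one-step mutual information. -/
def IsGreedy (S : Matrix (V × Fin M) (V × Fin M) ℝ) (σ : ℝ) (s : ℕ → V) : Prop :=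
  ∀ k v, (1 + (σ ^ 2)⁻¹ • block (postCov S σ s k) v).det ≤
    (1 + (σ ^ 2)⁻¹ • block (postCov S σ s k) (s k)).det

/-- Total number of samples taken by the end of epoch `ℓ`: in epoch `ℓ` one samples until the
trace of the posterior covariance at every vertex is at most `α ^ ℓ * τ`. -/
def sampleTotal (S : Matrix (V × Fin M) (V × Fin M) ℝ) (σ : ℝ) (s : ℕ → V) (α τ : ℝ) : ℕ → ℕ
  | 0 => 0
  | ℓ + 1 => sInf {k | sampleTotal S σ s α τ ℓ ≤ k ∧
      ∀ v, (block (postCov S σ s k) v).trace ≤ α ^ (ℓ + 1) * τ}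

end Estimation

/-- A run of DSMLC. `est ℓ` is the demand estimate at the end of the exploration of epoch `ℓ`
(`est 0` is the prior mean), `s` the sequence of sampling points, `n ℓ` the number of samples taken
by the end of epoch `ℓ`. Epochs are numbered from `1`; the fields for epoch `ℓ + 1` carry the
index `ℓ`. Its exploration phase consists of the slots in `(tExp ℓ, tInf ℓ]`, its information
propagation phase of those in `(tInf ℓ, tCov ℓ]`, and its coverage phase of those in
`(tCov ℓ, tExp (ℓ + 1)]`. Routing and travel take at most `ρ` slots per sampling point. The robots'
positions are otherwise unconstrained while they explore and report. -/
structure DSMLCRun {V : Type*} [Fintype V] [DecidableEq V] {N M : ℕ} {env : Environment V N M}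
    (tb : env.TieBreak) (l u ρ : ℕ) (β : ℝ) (s : ℕ → V) (n : ℕ → ℕ) (est : ℕ → Demand V M) where
  comm : ℕ → Option (Fin N)
  comm_federated : IsFederated l u comm
  η : ℕ → Config V N
  P : ℕ → Coverings V N M
  covering_zero : IsCovering (P 0)
  tExp : ℕ → ℕ
  tInf : ℕ → ℕ
  tCov : ℕ → ℕ
  tExp_zero : tExp 0 = 0
  /-- duration of the exploration phase -/
  tExp_le_tInf : ∀ ℓ, tExp ℓ ≤ tInf ℓ
  tInf_le : ∀ ℓ, tInf ℓ ≤ tExp ℓ + ρ * (n (ℓ + 1) - n ℓ)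
  /-- each sampling point is assigned to a robot whose current multitask center is nearest -/
  assign : ℕ → Fin N
  assign_nearest : ∀ ℓ, ∃ c, env.IsCenters (est ℓ) (P (tExp ℓ)) c ∧
    ∀ k, n ℓ ≤ k → k < n (ℓ + 1) →
      ∀ i, env.gdist (c (assign k)) (s k) ≤ env.gdist (c i) (s k)
  /-- the assigned robot visits the sampling point during the exploration phase, and takes at most
  one sample per slot -/
  visit : ℕ → ℕ
  visit_mem : ∀ ℓ k, n ℓ ≤ k → k < n (ℓ + 1) → tExp ℓ < visit k ∧ visit k ≤ tInf ℓ
  visit_at : ∀ ℓ k, n ℓ ≤ k → k < n (ℓ + 1) → η (visit k) (assign k) = s k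
  visit_inj : ∀ ℓ k k', n ℓ ≤ k → k < n (ℓ + 1) → n ℓ ≤ k' → k' < n (ℓ + 1) →
    visit k = visit k' → assign k = assign k' → k = k'
  /-- information propagation ends as soon as every robot has communicated -/
  tCov_isLeast : ∀ ℓ, IsLeast {t | tInf ℓ ≤ t ∧ ∀ i, ∃ t', tInf ℓ < t' ∧ t' ≤ t ∧
    comm t' = some i} (tCov ℓ)
  /-- the coverings do not change outside the coverage phases -/
  P_const : ∀ ℓ t, tExp ℓ ≤ t → t < tCov ℓ → P (t + 1) = P t
  /-- duration of the coverage phase -/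
  tExp_succ : ∀ ℓ, tExp (ℓ + 1) = tCov ℓ + ⌈β ^ (ℓ + 1)⌉₊
  /-- the coverage algorithm is run with the current estimate -/
  coverage_step : ∀ ℓ t, tCov ℓ ≤ t → t < tExp (ℓ + 1) →
    Environment.FMCStep tb (est (ℓ + 1)) (comm (t + 1)) (η t) (P t) (η (t + 1)) (P (t + 1))

end

end MultitaskCoverage

open MeasureTheory ProbabilityTheory MultitaskCoverage
open scoped Asymptotics

/-!
Choose the most sampled of the vertices after `k` samples and let `m < k` be the last time it was
sampled. It has been observed at least `k / |V| - 1` times before, so its posterior block at time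
`m` has trace `O(1 / k)`. As `1 + tr B ≤ det (1 + B) ≤ exp (tr B)` for positive semidefinite `B`,
and this vertex maximized the determinant at time `m`, all other blocks have trace `O(1 / k)` at
time `m`, and the more so at time `k`. Hence `O(α ^ (-ℓ))` samples suffice for the first `ℓ`
explorations.

In a coverage phase every move strictly decreases `H_inf` for the current estimate. There are
finitely many configurations, so after boundedly many slots no single robot can improve the
configuration, and after two further rounds of communication the coverings are the equitable
partitions. From then on the regret is at most a constant times the `ℓ¹` estimation error; before,
it is at most a constant times the norm of the demand.

The posterior covariance is the covariance of the estimation error, which is therefore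
`O(α ^ (ℓ / 2))` in mean during the `ℓ`-th coverage phase. So exploration contributes
`O(α ^ (-ℓ))` and coverage `O(β ^ ℓ * α ^ (ℓ / 2))` to the expected regret of the first `ℓ` epochs,
both equal to `O(β ^ (2 * ℓ / 3))` for `α = β ^ (-2 / 3)`, while these epochs last at least `β ^ ℓ`
slots. Only first and second moments enter. Conditioning on a nonnegative demand divides these
bounds by the probability of that event.
-/

namespace MultitaskCoverage

section GaussianPosterior

open Matrix
open scoped ComplexOrder MatrixOrder

section PosteriorCovariance

variable {𝕜 ι : Type*} [RCLike 𝕜] [Fintype ι] [DecidableEq ι] {S D E : Matrix ι ι 𝕜}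

/-- Posterior covariance of a Gaussian vector with covariance `S` after linear observations with
Gaussian noise that carry the information (precision) matrix `D`. It equals `(S⁻¹ + D)⁻¹` for an
invertible `S`. -/
noncomputable def posteriorCov (S D : Matrix ι ι 𝕜) : Matrix ι ι 𝕜 :=
  (1 + S * D)⁻¹ * S

theorem isUnit_det_one_add_mul (hS : S.PosSemidef) (hD : D.PosSemidef) :
    IsUnit (1 + S * D).det := by
  obtain ⟨B, rfl⟩ := CStarAlgebra.nonneg_iff_eq_star_mul_self.mp hD.nonneg
  rw [star_eq_conjTranspose]
  rw [← mul_assoc, det_one_add_mul_comm, ← mul_assoc]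
  exact (PosDef.one.add_posSemidef (hS.mul_mul_conjTranspose_same B)).det_pos.ne'.isUnit

theorem one_add_mul_mul_posteriorCov (hS : S.PosSemidef) (hD : D.PosSemidef) :
    (1 + S * D) * posteriorCov S D = S :=
  mul_nonsing_inv_cancel_left _ _ (isUnit_det_one_add_mul hS hD)

theorem posteriorCov_mul_one_add_mul (hS : S.PosSemidef) (hD : D.PosSemidef) :
    posteriorCov S D * (1 + D * S) = S := by
  rw [posteriorCov, mul_assoc, show S * (1 + D * S) = (1 + S * D) * S by noncomm_ring,
    nonsing_inv_mul_cancel_left _ _ (isUnit_det_one_add_mul hS hD)]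

theorem conjTranspose_one_add_mul (hS : S.IsHermitian) (hD : D.IsHermitian) :
    (1 + S * D)ᴴ = 1 + D * S := by
  rw [conjTranspose_add, conjTranspose_one, conjTranspose_mul, hS.eq, hD.eq]

theorem posteriorCov_eq_mul_mul_conjTranspose (hS : S.PosSemidef) (hD : D.PosSemidef) :
    posteriorCov S D = (1 + S * D)⁻¹ * (S + S * D * S) * ((1 + S * D)⁻¹)ᴴ := by
  have hDS : IsUnit (1 + D * S).det := isUnit_det_one_add_mul hD hS
  rw [conjTranspose_nonsing_inv, conjTranspose_one_add_mul hS.isHermitian hD.isHermitian,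
    show S + S * D * S = S * (1 + D * S) by noncomm_ring, ← mul_assoc (1 + S * D)⁻¹,
    mul_nonsing_inv_cancel_right _ _ hDS, posteriorCov]

theorem posSemidef_posteriorCov (hS : S.PosSemidef) (hD : D.PosSemidef) :
    (posteriorCov S D).PosSemidef := by
  have hSDS : (S * D * S).PosSemidef := by
    simpa only [hS.isHermitian.eq] using hD.mul_mul_conjTranspose_same S
  rw [posteriorCov_eq_mul_mul_conjTranspose hS hD]
  exact (hS.add hSDS).mul_mul_conjTranspose_same _

theorem posteriorCov_add (hS : S.PosSemidef) (hD : D.PosSemidef) :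
    posteriorCov S (D + E) = posteriorCov (posteriorCov S D) E := by
  have hfactor : 1 + S * (D + E) = (1 + S * D) * (1 + posteriorCov S D * E) := by
    rw [mul_add (1 + S * D), ← mul_assoc (1 + S * D), one_add_mul_mul_posteriorCov hS hD]
    noncomm_ring
  rw [posteriorCov, hfactor, Matrix.mul_inv_rev, mul_assoc]
  rfl

theorem posSemidef_sub_posteriorCov (hS : S.PosSemidef) (hD : D.PosSemidef) :
    (S - posteriorCov S D).PosSemidef := by
  set C := posteriorCov S D
  have hC : Cᴴ = C := (posSemidef_posteriorCov hS hD).isHermitian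
  have hleft : S = C + C * D * S := by
    rw [mul_assoc, ← mul_one_add, posteriorCov_mul_one_add_mul hS hD]
  have hright : S = C + S * D * C := by
    rw [← one_add_mul, one_add_mul_mul_posteriorCov hS hD]
  have hdecomp : S - C = C * D * Cᴴ + (C * D) * S * (C * D)ᴴ := by
    rw [conjTranspose_mul, hC, hD.isHermitian.eq]
    calc S - C = C * D * S := sub_eq_of_eq_add' hleft
      _ = C * D * (C + S * D * C) := congrArg (C * D * ·) hright
      _ = C * D * C + C * D * S * (D * C) := by noncomm_ring
  rw [hdecomp]
  exact (hD.mul_mul_conjTranspose_same C).add (hS.mul_mul_conjTranspose_same _)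

theorem posSemidef_posteriorCov_sub_posteriorCov (hS : S.PosSemidef) (hD : D.PosSemidef)
    (hDE : (E - D).PosSemidef) : (posteriorCov S D - posteriorCov S E).PosSemidef := by
  rw [← add_sub_cancel D E, posteriorCov_add hS hD]
  exact posSemidef_sub_posteriorCov (posSemidef_posteriorCov hS hD) hDE

theorem posteriorCov_swap (hS : S.PosSemidef) (hD : D.PosSemidef) :
    posteriorCov D S = D - D * posteriorCov S D * D := by
  have hfactor : (1 + D * S) * (D - D * posteriorCov S D * D) = D := by
    calc (1 + D * S) * (D - D * posteriorCov S D * D)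
        = D + D * S * D - D * ((1 + S * D) * posteriorCov S D) * D := by noncomm_ring
      _ = D := by rw [one_add_mul_mul_posteriorCov hS hD, add_sub_cancel_right]
  calc posteriorCov D S
      = (1 + D * S)⁻¹ * ((1 + D * S) * (D - D * posteriorCov S D * D)) := by
        rw [hfactor, posteriorCov]
    _ = D - D * posteriorCov S D * D :=
        nonsing_inv_mul_cancel_left _ _ (isUnit_det_one_add_mul hD hS)

theorem posteriorCov_diagonal_apply_le_inv (hS : S.PosSemidef) {d : ι → 𝕜} (hd : 0 ≤ d)
    {i : ι} (hi : 0 < d i) : posteriorCov S (diagonal d) i i ≤ (d i)⁻¹ := by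
  have hD : (diagonal d).PosSemidef := PosSemidef.diagonal hd
  have hnonneg := (posSemidef_posteriorCov hD hS).diag_nonneg (i := i)
  rw [posteriorCov_swap hS hD, Matrix.sub_apply, mul_diagonal, diagonal_mul, diagonal_apply_eq,
    sub_nonneg] at hnonneg
  have : 0 ≤ (d i)⁻¹ := (inv_pos.mpr hi).le
  calc posteriorCov S (diagonal d) i i
      = (d i)⁻¹ * (d i * posteriorCov S (diagonal d) i i * d i) * (d i)⁻¹ := by
        field_simp [hi.ne']
    _ ≤ (d i)⁻¹ * d i * (d i)⁻¹ := by gcongr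
    _ = (d i)⁻¹ := by rw [inv_mul_cancel₀ hi.ne', one_mul]

end PosteriorCovariance

section DetTrace

theorem one_add_sum_le_prod_one_add {ι R : Type*} [CommSemiring R] [PartialOrder R]
    [IsOrderedRing R] (s : Finset ι) {f : ι → R} (hf : ∀ i ∈ s, 0 ≤ f i) :
    1 + ∑ i ∈ s, f i ≤ ∏ i ∈ s, (1 + f i) := by
  classical
  induction s using Finset.induction_on with
  | empty => simp
  | insert a s ha ih =>
    rw [Finset.forall_mem_insert] at hf
    rw [Finset.sum_insert ha, Finset.prod_insert ha]
    have hsum : 0 ≤ f a * ∑ i ∈ s, f i := mul_nonneg hf.1 (Finset.sum_nonneg hf.2)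
    calc 1 + (f a + ∑ i ∈ s, f i)
        ≤ 1 + (f a + ∑ i ∈ s, f i) + f a * ∑ i ∈ s, f i := le_add_of_nonneg_right hsum
      _ = (1 + f a) * (1 + ∑ i ∈ s, f i) := by ring
      _ ≤ _ := mul_le_mul_of_nonneg_left (ih hf.2) (add_nonneg zero_le_one hf.1)

variable {𝕜 m : Type*} [RCLike 𝕜] [Fintype m] [DecidableEq m] {B : Matrix m m 𝕜}

theorem det_one_add_eq_prod_eigenvalues (hB : B.IsHermitian) :
    (1 + B).det = ∏ i, (1 + (hB.eigenvalues i : 𝕜)) := by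
  conv_lhs =>
    rw [hB.spectral_theorem, Unitary.conjStarAlgAut_apply, det_one_add_mul_comm, ← mul_assoc]
  rw [Unitary.coe_star_mul_self, one_mul, ← diagonal_one, diagonal_add, det_diagonal]
  rfl

theorem one_add_trace_le_det_one_add (hB : B.PosSemidef) : 1 + B.trace ≤ (1 + B).det := by
  rw [det_one_add_eq_prod_eigenvalues hB.isHermitian, hB.isHermitian.trace_eq_sum_eigenvalues]
  exact one_add_sum_le_prod_one_add _ fun i _ =>
    RCLike.ofReal_nonneg.mpr (hB.eigenvalues_nonneg i)

theorem re_det_one_add_le_exp_re_trace (hB : B.PosSemidef) :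
    RCLike.re (1 + B).det ≤ Real.exp (RCLike.re B.trace) := by
  rw [det_one_add_eq_prod_eigenvalues hB.isHermitian, hB.isHermitian.trace_eq_sum_eigenvalues]
  have h := Real.prod_one_add_le_exp_sum Finset.univ hB.eigenvalues_nonneg
  exact_mod_cast h

end DetTrace

section SampleCount

variable {V : Type*} [DecidableEq V]

theorem sampleCount_eq_count (s : ℕ → V) (k : ℕ) (v : V) :
    sampleCount s k v = Nat.count (s · = v) k :=
  (Nat.count_eq_card_filter_range _ k).symm

theorem sampleCount_mono (s : ℕ → V) (v : V) : Monotone (sampleCount s · v) := by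
  simpa only [sampleCount_eq_count] using Nat.count_monotone (s · = v)

theorem exists_lt_sampleCount_succ_eq {s : ℕ → V} {v : V} {k : ℕ} (hk : 0 < sampleCount s k v) :
    ∃ m < k, s m = v ∧ sampleCount s m v + 1 = sampleCount s k v := by
  simp only [sampleCount_eq_count] at hk ⊢
  induction k with
  | zero => simp at hk
  | succ k ih =>
    rw [Nat.count_succ] at hk ⊢
    split_ifs at hk ⊢ with hkv
    · exact ⟨k, k.lt_succ_self, hkv, rfl⟩
    · obtain ⟨m, hmk, hm⟩ := ih hk
      exact ⟨m, hmk.trans k.lt_succ_self, hm⟩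

theorem exists_le_card_mul_sampleCount [Fintype V] (s : ℕ → V) (k : ℕ) :
    ∃ v, k ≤ Fintype.card V * sampleCount s k v := by
  have : Nonempty V := ⟨s 0⟩
  by_contra! h
  have hsum : ∑ v, sampleCount s k v = k :=
    (Finset.card_eq_sum_card_fiberwise fun m _ => Finset.mem_univ (s m)).symm.trans
      (Finset.card_range k)
  have hlt : ∑ v, Fintype.card V * sampleCount s k v < ∑ _v : V, k :=
    Finset.sum_lt_sum_of_nonempty Finset.univ_nonempty fun v _ => h v
  rw [← Finset.mul_sum, hsum, Finset.sum_const, smul_eq_mul, Finset.card_univ] at hlt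
  exact hlt.false

theorem exists_lt_le_card_mul_sampleCount_add_one [Fintype V] (s : ℕ → V) {k : ℕ} (hk : 0 < k) :
    ∃ m < k, k ≤ Fintype.card V * (sampleCount s m (s m) + 1) := by
  obtain ⟨v, hv⟩ := exists_le_card_mul_sampleCount s k
  have hpos : 0 < sampleCount s k v := Nat.pos_of_mul_pos_left (hk.trans_le hv)
  obtain ⟨m, hmk, rfl, hm⟩ := exists_lt_sampleCount_succ_eq hpos
  exact ⟨m, hmk, hm ▸ hv⟩

end SampleCount

section GreedySampling

variable {V : Type*} [DecidableEq V] {M : ℕ}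

theorem samplePrecision_eq_diagonal (σ : ℝ) (s : ℕ → V) (k : ℕ) :
    samplePrecision M σ s k = diagonal fun p => (sampleCount s k p.1 : ℝ) / σ ^ 2 := by
  rw [samplePrecision, ← diagonal_one, diagonal_kronecker_diagonal]
  simp only [mul_one]

theorem posSemidef_samplePrecision (σ : ℝ) (s : ℕ → V) (k : ℕ) :
    (samplePrecision M σ s k).PosSemidef := by
  rw [samplePrecision_eq_diagonal]
  exact PosSemidef.diagonal fun p => by positivity

theorem posSemidef_samplePrecision_sub (σ : ℝ) (s : ℕ → V) {m k : ℕ} (hmk : m ≤ k) :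
    (samplePrecision M σ s k - samplePrecision M σ s m).PosSemidef := by
  simp only [samplePrecision_eq_diagonal, diagonal_sub]
  refine PosSemidef.diagonal fun p => sub_nonneg.mpr ?_
  have := sampleCount_mono s p.1 hmk
  gcongr

variable [Fintype V] {S : Matrix (V × Fin M) (V × Fin M) ℝ} {σ : ℝ} {s : ℕ → V}

theorem postCov_eq_posteriorCov (S : Matrix (V × Fin M) (V × Fin M) ℝ) (σ : ℝ) (s : ℕ → V)
    (k : ℕ) : postCov S σ s k = posteriorCov S (samplePrecision M σ s k) :=
  rfl

theorem posSemidef_postCov (hS : S.PosSemidef) (σ : ℝ) (s : ℕ → V) (k : ℕ) :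
    (postCov S σ s k).PosSemidef :=
  posSemidef_posteriorCov hS (posSemidef_samplePrecision σ s k)

theorem postCov_zero (S : Matrix (V × Fin M) (V × Fin M) ℝ) (σ : ℝ) (s : ℕ → V) :
    postCov S σ s 0 = S := by
  simp [postCov, samplePrecision, sampleCount]

theorem trace_block_postCov_antitone (hS : S.PosSemidef) (σ : ℝ) (s : ℕ → V) (v : V) :
    Antitone fun k => (block (postCov S σ s k) v).trace := fun m k hmk => by
  have h := posSemidef_posteriorCov_sub_posteriorCov hS (posSemidef_samplePrecision σ s m)
    (posSemidef_samplePrecision_sub σ s hmk)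
  have htrace := (h.submatrix (v, ·)).trace_nonneg
  rw [submatrix_sub, Pi.sub_apply, Pi.sub_apply, trace_sub] at htrace
  exact sub_nonneg.mp htrace

theorem sampleCount_mul_trace_block_postCov_le (hS : S.PosSemidef) (hσ : σ ≠ 0) (s : ℕ → V)
    (k : ℕ) (v : V) : sampleCount s k v * (block (postCov S σ s k) v).trace ≤ M * σ ^ 2 := by
  rcases (sampleCount s k v).eq_zero_or_pos with hv | hv
  · rw [hv, Nat.cast_zero, zero_mul]
    positivity
  have hdiag (j : Fin M) : postCov S σ s k (v, j) (v, j) ≤ σ ^ 2 / sampleCount s k v := by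
    rw [postCov_eq_posteriorCov, samplePrecision_eq_diagonal, ← inv_div]
    exact posteriorCov_diagonal_apply_le_inv hS (fun p => by positivity) (by positivity)
  have htrace : (block (postCov S σ s k) v).trace ≤ M * (σ ^ 2 / sampleCount s k v) := by
    calc (block (postCov S σ s k) v).trace
        ≤ ∑ _j : Fin M, σ ^ 2 / sampleCount s k v := Finset.sum_le_sum fun j _ => hdiag j
      _ = M * (σ ^ 2 / sampleCount s k v) := by simp
  rw [← mul_div_assoc, le_div_iff₀ (by positivity)] at htrace
  rwa [mul_comm]

theorem trace_block_le_exp_sub_one_of_isGreedy (hS : S.PosSemidef) (hs : IsGreedy S σ s) (k : ℕ)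
    (v : V) : (σ ^ 2)⁻¹ * (block (postCov S σ s k) v).trace ≤
      Real.exp ((σ ^ 2)⁻¹ * (block (postCov S σ s k) (s k)).trace) - 1 := by
  have hpsd (v' : V) : ((σ ^ 2)⁻¹ • block (postCov S σ s k) v').PosSemidef :=
    ((posSemidef_postCov hS σ s k).submatrix _).smul (by positivity)
  have hlower := one_add_trace_le_det_one_add (hpsd v)
  have hupper := re_det_one_add_le_exp_re_trace (hpsd (s k))
  simp only [trace_smul, smul_eq_mul, RCLike.re_to_real] at hlower hupper
  linarith [hs k v]

theorem exp_sub_one_le_mul_exp (x : ℝ) : Real.exp x - 1 ≤ x * Real.exp x := by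
  have h := mul_le_mul_of_nonneg_right (Real.one_sub_le_exp_neg x) (Real.exp_pos x).le
  rw [← Real.exp_add, neg_add_cancel, Real.exp_zero] at h
  linarith

/-- The constant in the `O(1 / k)` decay of the posterior variances under greedy sampling, for
prior variances bounded by `τ`. -/
noncomputable def greedyConst (V : Type*) [Fintype V] (M : ℕ) (σ τ : ℝ) : ℝ :=
  Fintype.card V * ((M * σ ^ 2 + τ) * Real.exp ((σ ^ 2)⁻¹ * τ))

theorem mul_trace_block_postCov_le_of_isGreedy (hS : S.PosSemidef) (hσ : σ ≠ 0)
    (hs : IsGreedy S σ s) {τ : ℝ} (hτ : ∀ v, (block S v).trace ≤ τ) (k : ℕ) (v : V) :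
    k * (block (postCov S σ s k) v).trace ≤ greedyConst V M σ τ := by
  have htrace (k : ℕ) (v : V) : 0 ≤ (block (postCov S σ s k) v).trace :=
    ((posSemidef_postCov hS σ s k).submatrix _).trace_nonneg
  have hτ' (k : ℕ) (v : V) : (block (postCov S σ s k) v).trace ≤ τ := by
    refine (trace_block_postCov_antitone hS σ s v k.zero_le).trans ?_
    simpa only [postCov_zero] using hτ v
  have hτ₀ : 0 ≤ τ := (htrace 0 v).trans (hτ' 0 v)
  rcases k.eq_zero_or_pos with rfl | hk
  · rw [Nat.cast_zero, zero_mul, greedyConst]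
    positivity
  obtain ⟨m, hmk, hkm⟩ := exists_lt_le_card_mul_sampleCount_add_one s hk
  set c := sampleCount s m (s m)
  set t := (block (postCov S σ s m) (s m)).trace
  have hstep : (block (postCov S σ s m) v).trace ≤ t * Real.exp ((σ ^ 2)⁻¹ * τ) := by
    have hle := (trace_block_le_exp_sub_one_of_isGreedy hS hs m v).trans (exp_sub_one_le_mul_exp _)
    rw [mul_assoc, mul_le_mul_iff_right₀ (by positivity)] at hle
    have ht : 0 ≤ t := htrace m (s m)
    have htτ : t ≤ τ := hτ' m (s m)
    exact hle.trans (by gcongr)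
  have hcount : (c + 1) * t ≤ M * σ ^ 2 + τ := by
    rw [add_one_mul]
    exact add_le_add (sampleCount_mul_trace_block_postCov_le hS hσ s m (s m)) (hτ' m (s m))
  calc k * (block (postCov S σ s k) v).trace
      ≤ (Fintype.card V * (c + 1)) * (block (postCov S σ s m) v).trace := by
        gcongr
        · exact htrace k v
        · exact_mod_cast hkm
        · exact trace_block_postCov_antitone hS σ s v hmk.le
    _ ≤ (Fintype.card V * (c + 1)) * (t * Real.exp ((σ ^ 2)⁻¹ * τ)) := by gcongr
    _ = Fintype.card V * ((c + 1) * t * Real.exp ((σ ^ 2)⁻¹ * τ)) := by ring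
    _ ≤ greedyConst V M σ τ := by
        rw [greedyConst]
        gcongr

end GreedySampling

section SampleTotal

open Filter

variable {V : Type*} [DecidableEq V] [Fintype V] {M : ℕ} {S : Matrix (V × Fin M) (V × Fin M) ℝ}
  {σ : ℝ} {s : ℕ → V} {α τ : ℝ}

theorem sampleTotal_succ_mem
    (h : ∀ ℓ, ∀ᶠ k in atTop, ∀ v, (block (postCov S σ s k) v).trace ≤ α ^ ℓ * τ) (ℓ : ℕ) :
    sampleTotal S σ s α τ ℓ ≤ sampleTotal S σ s α τ (ℓ + 1) ∧
      ∀ v, (block (postCov S σ s (sampleTotal S σ s α τ (ℓ + 1))) v).trace ≤ α ^ (ℓ + 1) * τ :=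
  Nat.sInf_mem (s := {k | sampleTotal S σ s α τ ℓ ≤ k ∧
    ∀ v, (block (postCov S σ s k) v).trace ≤ α ^ (ℓ + 1) * τ})
    ((eventually_ge_atTop _).and (h (ℓ + 1))).exists

theorem sampleTotal_mono
    (h : ∀ ℓ, ∀ᶠ k in atTop, ∀ v, (block (postCov S σ s k) v).trace ≤ α ^ ℓ * τ) :
    Monotone (sampleTotal S σ s α τ) :=
  monotone_nat_of_le_succ fun ℓ => (sampleTotal_succ_mem h ℓ).1

theorem trace_block_postCov_sampleTotal_le
    (h : ∀ ℓ, ∀ᶠ k in atTop, ∀ v, (block (postCov S σ s k) v).trace ≤ α ^ ℓ * τ)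
    (hτ : ∀ v, (block S v).trace ≤ τ) (ℓ : ℕ) (v : V) :
    (block (postCov S σ s (sampleTotal S σ s α τ ℓ)) v).trace ≤ α ^ ℓ * τ := by
  cases ℓ with
  | zero => simpa only [sampleTotal, postCov_zero, pow_zero, one_mul] using hτ v
  | succ ℓ => exact (sampleTotal_succ_mem h ℓ).2 v

theorem sampleTotal_le {K : ℕ → ℕ} (hK : Monotone K)
    (h : ∀ ℓ, ∀ k ≥ K ℓ, ∀ v, (block (postCov S σ s k) v).trace ≤ α ^ ℓ * τ) (ℓ : ℕ) :
    sampleTotal S σ s α τ ℓ ≤ K ℓ := by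
  induction ℓ with
  | zero => exact Nat.zero_le _
  | succ ℓ ih => exact Nat.sInf_le ⟨ih.trans (hK ℓ.le_succ), h (ℓ + 1) _ le_rfl⟩

theorem trace_block_postCov_le_of_isGreedy (hS : S.PosSemidef) (hσ : σ ≠ 0) (hs : IsGreedy S σ s)
    (hτ : ∀ v, (block S v).trace ≤ τ) {r : ℝ} (hr : 0 < r) {k : ℕ}
    (hk : greedyConst V M σ τ / (r * τ) ≤ k) (v : V) :
    (block (postCov S σ s k) v).trace ≤ r * τ := by
  have hτ₀ : 0 ≤ τ := (hS.submatrix (v, ·)).trace_nonneg.trans (hτ v)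
  rcases hτ₀.eq_or_lt with rfl | hτ₀
  · rw [mul_zero]
    refine (trace_block_postCov_antitone hS σ s v k.zero_le).trans ?_
    simpa only [postCov_zero] using hτ v
  have : Nonempty V := ⟨v⟩
  have hC : 0 < greedyConst V M σ τ := by
    have := Fintype.card_pos (α := V)
    rw [greedyConst]
    positivity
  have hk₀ : (0 : ℝ) < k := (by positivity : 0 < greedyConst V M σ τ / (r * τ)).trans_le hk
  refine le_of_mul_le_mul_left ?_ hk₀
  calc k * (block (postCov S σ s k) v).trace
      ≤ greedyConst V M σ τ := mul_trace_block_postCov_le_of_isGreedy hS hσ hs hτ k v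
    _ ≤ k * (r * τ) := (div_le_iff₀ (by positivity)).mp hk

theorem eventually_trace_block_postCov_le_of_isGreedy (hS : S.PosSemidef) (hσ : σ ≠ 0)
    (hs : IsGreedy S σ s) (hτ : ∀ v, (block S v).trace ≤ τ) {r : ℝ} (hr : 0 < r) :
    ∀ᶠ k in atTop, ∀ v, (block (postCov S σ s k) v).trace ≤ r * τ := by
  filter_upwards [tendsto_natCast_atTop_atTop.eventually_ge_atTop
    (greedyConst V M σ τ / (r * τ))] with k hk v
  exact trace_block_postCov_le_of_isGreedy hS hσ hs hτ hr hk v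

theorem sampleTotal_le_of_isGreedy (hS : S.PosSemidef) (hσ : σ ≠ 0) (hs : IsGreedy S σ s)
    (hτ : ∀ v, (block S v).trace ≤ τ) (hα₀ : 0 < α) (hα₁ : α ≤ 1) (ℓ : ℕ) :
    (sampleTotal S σ s α τ ℓ : ℝ) ≤ (greedyConst V M σ τ / τ + 1) * (α ^ ℓ)⁻¹ := by
  have hτ₀ : 0 ≤ τ := (hS.submatrix (s 0, ·)).trace_nonneg.trans (hτ (s 0))
  have hC : 0 ≤ greedyConst V M σ τ / τ := by
    rw [greedyConst]
    positivity
  have hdiv (ℓ : ℕ) :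
      greedyConst V M σ τ / (α ^ ℓ * τ) = greedyConst V M σ τ / τ * (α ^ ℓ)⁻¹ := by
    rw [mul_comm, ← div_div, div_eq_mul_inv _ (α ^ ℓ)]
  have hmono : Monotone fun ℓ => ⌈greedyConst V M σ τ / (α ^ ℓ * τ)⌉₊ := fun a b hab => by
    simp only [hdiv]
    have := pow_le_pow_of_le_one hα₀.le hα₁ hab
    gcongr
  have hle : sampleTotal S σ s α τ ℓ ≤ ⌈greedyConst V M σ τ / (α ^ ℓ * τ)⌉₊ :=
    sampleTotal_le hmono (fun ℓ k hk => trace_block_postCov_le_of_isGreedy hS hσ hs hτ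
      (pow_pos hα₀ ℓ) (Nat.ceil_le.mp hk)) ℓ
  have hone : 1 ≤ (α ^ ℓ)⁻¹ := (one_le_inv₀ (by positivity)).mpr (pow_le_one₀ hα₀.le hα₁)
  calc (sampleTotal S σ s α τ ℓ : ℝ)
      ≤ greedyConst V M σ τ / τ * (α ^ ℓ)⁻¹ + 1 := by
        rw [← hdiv]
        exact (Nat.cast_le.mpr hle).trans (Nat.ceil_lt_add_one (by rw [hdiv]; positivity)).le
    _ ≤ (greedyConst V M σ τ / τ + 1) * (α ^ ℓ)⁻¹ := by
        rw [add_one_mul]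
        gcongr

end SampleTotal

section SquaredExponential

open BoundedContinuousFunction in
theorem posSemidef_re_charFun {ι E : Type*} [Finite ι] [NormedAddCommGroup E]
    [InnerProductSpace ℝ E] [MeasurableSpace E] [BorelSpace E]
    (ν : Measure E) [IsFiniteMeasure ν] (x : ι → E) :
    (Matrix.of fun i j => (charFun ν (x j - x i)).re).PosSemidef := by
  have hgram : (Matrix.of fun i j => (charFun ν (x j - x i)).re) =
      gram ℝ fun i => (innerProbChar (x i)).toLp (E := ℂ) 2 ν ℂ := by
    refine Matrix.ext fun i j => ?_
    rw [of_apply, gram_apply, L2.inner_def, charFun_eq_integral_innerProbChar,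
      ← RCLike.re_eq_complex_re, ← integral_re (integrable ν _)]
    refine integral_congr_ae ?_
    filter_upwards [coeFn_toLp (p := 2) (𝕜 := ℂ) ν (innerProbChar (x i)),
      coeFn_toLp (p := 2) (𝕜 := ℂ) ν (innerProbChar (x j))] with y hi hj
    rw [hi, hj, Complex.inner]
    simp only [innerProbChar_apply, ← Complex.exp_conj, map_mul,
      Complex.conj_ofReal, Complex.conj_I, ← Complex.exp_add, inner_sub_right,
      Complex.ofReal_sub, RCLike.re_eq_complex_re]
    ring_nf
  rw [hgram]
  exact posSemidef_gram ℝ _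

theorem posSemidef_seKernel {V : Type*} [Finite V] (pos : V → EuclideanSpace ℝ (Fin 2)) (σv : ℝ)
    {len : ℝ} (hlen : len ≠ 0) : (seKernel pos σv len).PosSemidef := by
  have hchar : seKernel pos σv len = σv ^ 2 • Matrix.of fun v v' =>
      (charFun (stdGaussian (EuclideanSpace ℝ (Fin 2))) (len⁻¹ • pos v' - len⁻¹ • pos v)).re := by
    refine Matrix.ext fun v v' => ?_
    have hexponent : -(dist (pos v) (pos v') ^ 2 / (2 * len ^ 2)) =
        -‖len⁻¹ • pos v' - len⁻¹ • pos v‖ ^ 2 / 2 := by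
      rw [← smul_sub, norm_smul, mul_pow, norm_inv, Real.norm_eq_abs, inv_pow, sq_abs,
        dist_comm, dist_eq_norm]
      field_simp
    rw [seKernel, of_apply, Matrix.smul_apply, of_apply, charFun_stdGaussian, hexponent,
      smul_eq_mul]
    norm_cast
  rw [hchar]
  exact (posSemidef_re_charFun _ _).smul (sq_nonneg σv)

end SquaredExponential

section SecondOrder

variable {Ω : Type*} [MeasurableSpace Ω] {P : Measure Ω} {ι ι' κ κ' : Type*}

/-- The matrix of covariances between the coordinates of two random vectors. -/
noncomputable def crossCov (X : Ω → ι → ℝ) (Y : Ω → κ → ℝ) (P : Measure Ω) : Matrix ι κ ℝ :=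
  Matrix.of fun i j => cov[fun ω => X ω i, fun ω => Y ω j; P]

/-- The random vector `X` has square-integrable coordinates, mean `m` and covariance matrix `C`. -/
structure HasMeanCov (X : Ω → ι → ℝ) (m : ι → ℝ) (C : Matrix ι ι ℝ) (P : Measure Ω) : Prop where
  memLp : ∀ i, MemLp (fun ω => X ω i) 2 P
  integral_eq : ∀ i, ∫ ω, X ω i ∂P = m i
  crossCov_eq : crossCov X X P = C

theorem transpose_crossCov (X : Ω → ι → ℝ) (Y : Ω → κ → ℝ) :
    (crossCov X Y P)ᵀ = crossCov Y X P :=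
  Matrix.ext fun _ _ => covariance_comm _ _

theorem memLp_mulVec [Fintype ι] {X : Ω → ι → ℝ} (hX : ∀ i, MemLp (fun ω => X ω i) 2 P)
    (A : Matrix ι' ι ℝ) (i : ι') : MemLp (fun ω => (A *ᵥ X ω) i) 2 P :=
  memLp_finsetSum _ fun j _ => (hX j).const_mul (A i j)

theorem crossCov_mulVec_mulVec [IsFiniteMeasure P] [Fintype ι] [Fintype κ] {X : Ω → ι → ℝ}
    {Y : Ω → κ → ℝ} (hX : ∀ i, MemLp (fun ω => X ω i) 2 P)
    (hY : ∀ i, MemLp (fun ω => Y ω i) 2 P) (A : Matrix ι' ι ℝ) (B : Matrix κ' κ ℝ) :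
    crossCov (fun ω => A *ᵥ X ω) (fun ω => B *ᵥ Y ω) P = A * crossCov X Y P * Bᵀ := by
  refine Matrix.ext fun i j => ?_
  simp only [crossCov, of_apply, mulVec, dotProduct, mul_apply, transpose_apply]
  rw [covariance_fun_sum_fun_sum (fun k => (hX k).const_mul _) fun k => (hY k).const_mul _,
    Finset.sum_comm]
  simp only [covariance_const_mul_left, covariance_const_mul_right, Finset.sum_mul]
  exact Finset.sum_congr rfl fun _ _ => Finset.sum_congr rfl fun _ _ => by ring

namespace HasMeanCov

variable {X : Ω → ι → ℝ} {Y : Ω → ι → ℝ} {m m' : ι → ℝ} {C C' : Matrix ι ι ℝ}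

theorem covariance_eq (hX : HasMeanCov X m C P) (i j : ι) :
    cov[fun ω => X ω i, fun ω => X ω j; P] = C i j :=
  congr_fun₂ hX.crossCov_eq i j

theorem integrable [IsFiniteMeasure P] (hX : HasMeanCov X m C P) (i : ι) :
    Integrable (fun ω => X ω i) P :=
  (hX.memLp i).integrable one_le_two

theorem mulVec [IsFiniteMeasure P] [Fintype ι] (hX : HasMeanCov X m C P) (A : Matrix κ ι ℝ) :
    HasMeanCov (fun ω => A *ᵥ X ω) (A *ᵥ m) (A * C * Aᵀ) P where
  memLp := memLp_mulVec hX.memLp A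
  integral_eq i := by
    simp only [Matrix.mulVec, dotProduct]
    rw [integral_finsetSum _ fun j _ => (hX.integrable j).const_mul _]
    simp only [integral_const_mul, hX.integral_eq]
  crossCov_eq := by rw [crossCov_mulVec_mulVec hX.memLp hX.memLp, hX.crossCov_eq]

theorem sub [IsFiniteMeasure P] (hX : HasMeanCov X m C P) (hY : HasMeanCov Y m' C' P)
    (hXY : crossCov X Y P = 0) : HasMeanCov (fun ω => X ω - Y ω) (m - m') (C + C') P where
  memLp i := (hX.memLp i).sub (hY.memLp i)
  integral_eq i := by
    simp only [Pi.sub_apply]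
    rw [integral_sub (hX.integrable i) (hY.integrable i), hX.integral_eq, hY.integral_eq]
  crossCov_eq := Matrix.ext fun i j => by
    have hYX : crossCov Y X P = 0 := by rw [← transpose_crossCov, hXY, transpose_zero]
    have hij : cov[fun ω => X ω i, fun ω => Y ω j; P] = 0 := congr_fun₂ hXY i j
    have hji : cov[fun ω => Y ω i, fun ω => X ω j; P] = 0 := congr_fun₂ hYX i j
    simp only [crossCov, of_apply, Pi.sub_apply]
    rw [covariance_fun_sub_fun_sub (hX.memLp i) (hY.memLp i) (hX.memLp j) (hY.memLp j),
      hX.covariance_eq, hY.covariance_eq, hij, hji, sub_zero, sub_zero, Matrix.add_apply]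

theorem sub_const [IsProbabilityMeasure P] (hX : HasMeanCov X m C P) (c : ι → ℝ) :
    HasMeanCov (fun ω => X ω - c) (m - c) C P where
  memLp i := (hX.memLp i).sub (memLp_const (c i))
  integral_eq i := by
    simp only [Pi.sub_apply]
    rw [integral_sub (hX.integrable i) (integrable_const _), integral_const, probReal_univ,
      one_smul, hX.integral_eq]
  crossCov_eq := Matrix.ext fun i j => by
    simp only [crossCov, of_apply, Pi.sub_apply]
    rw [covariance_sub_const_left (hX.integrable i), covariance_sub_const_right (hX.integrable j),
      hX.covariance_eq]

theorem integral_sq_eq (hX : HasMeanCov X 0 C P) (i : ι) :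
    ∫ ω, X ω i ^ 2 ∂P = C i i := by
  rw [← hX.covariance_eq, covariance_self (hX.memLp i).aemeasurable,
    variance_of_integral_eq_zero (hX.memLp i).aemeasurable (hX.integral_eq i)]

theorem posSemidef [IsFiniteMeasure P] [Finite ι] (hX : HasMeanCov X m C P) : C.PosSemidef := by
  have := Fintype.ofFinite ι
  refine PosSemidef.of_dotProduct_mulVec_nonneg ?_ fun x => ?_
  · rw [← hX.crossCov_eq]
    exact transpose_crossCov X X
  · have hvar := (hX.mulVec (replicateRow Unit x)).covariance_eq () ()
    rw [covariance_self (memLp_mulVec hX.memLp _ _).aemeasurable, Matrix.mul_assoc] at hvar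
    exact (variance_nonneg _ P).trans_eq hvar

end HasMeanCov

theorem hasMeanCov_of_hasLaw_multivariateGaussian [Fintype ι] [DecidableEq ι]
    {X : Ω → EuclideanSpace ℝ ι} {m : EuclideanSpace ℝ ι} {C : Matrix ι ι ℝ} (hC : C.PosSemidef)
    (hX : HasLaw X (multivariateGaussian m C) P) :
    HasMeanCov (fun ω i => X ω i) (fun i => m i) C P where
  memLp i := by
    have h : MemLp (fun x : EuclideanSpace ℝ ι => x i) 2 (multivariateGaussian m C) :=
      (EuclideanSpace.proj (𝕜 := ℝ) i).comp_memLp' IsGaussian.memLp_two_id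
    exact (hX.map_eq ▸ h).comp_of_map hX.aemeasurable
  integral_eq i := by
    have hcomp := hX.integral_comp (f := EuclideanSpace.proj (𝕜 := ℝ) i) (by fun_prop)
    rwa [ContinuousLinearMap.integral_comp_comm _ IsGaussian.integrable_fun_id,
      integral_id_multivariateGaussian] at hcomp
  crossCov_eq := Matrix.ext fun i j => by
    rw [← covariance_eval_multivariateGaussian hC i j (μ := m)]
    exact hX.covariance_fun_comp (f := fun x => x i) (g := fun x => x j)
      (by fun_prop) (by fun_prop)

theorem crossCov_eq_zero_of_indepFun {X : Ω → ι → ℝ} {Y : Ω → κ → ℝ}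
    (hX : ∀ i, MemLp (fun ω => X ω i) 2 P) (hY : ∀ i, MemLp (fun ω => Y ω i) 2 P)
    (h : IndepFun X Y P) : crossCov X Y P = 0 :=
  Matrix.ext fun i j => (h.comp (measurable_pi_apply i) (measurable_pi_apply j)).covariance_eq_zero
    (hX i) (hY j)

end SecondOrder

section PosteriorError

variable {Ω : Type*} [MeasurableSpace Ω] {P : Measure Ω}

theorem HasMeanCov.sub_posterior [IsProbabilityMeasure P] {ι : Type*} [Fintype ι] [DecidableEq ι]
    {X ξ : Ω → ι → ℝ} {m : ι → ℝ} {S D : Matrix ι ι ℝ} (hX : HasMeanCov X m S P)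
    (hξ : HasMeanCov ξ 0 D P) (hXξ : crossCov X ξ P = 0) :
    HasMeanCov (fun ω => X ω - (1 + S * D)⁻¹ *ᵥ (m + S *ᵥ (D *ᵥ X ω + ξ ω))) 0
      (posteriorCov S D) P := by
  have hS := hX.posSemidef
  have hu := isUnit_det_one_add_mul hS hξ.posSemidef
  have herr (ω : Ω) : X ω - (1 + S * D)⁻¹ *ᵥ (m + S *ᵥ (D *ᵥ X ω + ξ ω)) =
      (1 + S * D)⁻¹ *ᵥ (X ω - S *ᵥ ξ ω - m) := by
    have hX₁ : X ω = (1 + S * D)⁻¹ *ᵥ (X ω + S *ᵥ (D *ᵥ X ω)) := by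
      rw [mulVec_mulVec _ S D]
      nth_rw 2 [← one_mulVec (X ω)]
      rw [← add_mulVec, mulVec_mulVec, nonsing_inv_mul _ hu, one_mulVec]
    nth_rw 1 [hX₁]
    rw [← mulVec_sub, mulVec_add S]
    congr 1
    abel
  have hcross : crossCov X (fun ω => S *ᵥ ξ ω) P = 0 := by
    simpa only [one_mulVec, hXξ, Matrix.mul_zero, Matrix.zero_mul] using
      crossCov_mulVec_mulVec hX.memLp hξ.memLp (1 : Matrix ι ι ℝ) S
  have hcov := ((hX.sub (hξ.mulVec S) hcross).sub_const m).mulVec (1 + S * D)⁻¹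
  simp only [← herr] at hcov
  have hS' : Sᵀ = S := hS.isHermitian
  rwa [mulVec_zero, sub_zero, sub_self, mulVec_zero, hS', ← conjTranspose_eq_transpose_of_trivial,
    ← posteriorCov_eq_mul_mul_conjTranspose hS hξ.posSemidef] at hcov

variable {V : Type*} [DecidableEq V] {M : ℕ}

theorem sampleSum_add [Fintype V] (σ : ℝ) (s : ℕ → V) (φ : V × Fin M → ℝ) (e : ℕ → Fin M → ℝ)
    (k : ℕ) : sampleSum σ s (fun m j => φ (s m, j) + e m j) k =
      samplePrecision M σ s k *ᵥ φ + sampleSum σ s e k := by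
  ext p
  have hconst : ∑ m ∈ Finset.range k with s m = p.1, φ (s m, p.2) = sampleCount s k p.1 * φ p := by
    rw [sampleCount, ← nsmul_eq_mul]
    refine Finset.sum_eq_card_nsmul fun m hm => ?_
    rw [(Finset.mem_filter.mp hm).2]
  rw [samplePrecision_eq_diagonal, Pi.add_apply, mulVec_diagonal]
  simp only [sampleSum, Finset.sum_add_distrib, hconst]
  ring

theorem hasMeanCov_sampleSum [IsFiniteMeasure P] {σ : ℝ} (hσ : σ ≠ 0) {ε : ℕ → Ω → Fin M → ℝ}
    (hε : ∀ k, HasMeanCov (ε k) 0 (σ ^ 2 • (1 : Matrix (Fin M) (Fin M) ℝ)) P)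
    (hεε : Pairwise fun k k' => crossCov (ε k) (ε k') P = 0) (s : ℕ → V) (k : ℕ) :
    HasMeanCov (fun ω => sampleSum σ s (ε · ω) k) 0 (samplePrecision M σ s k) P where
  memLp p := by
    simp only [sampleSum, div_eq_mul_inv]
    exact (memLp_finsetSum _ fun m _ => (hε m).memLp p.2).mul_const _
  integral_eq p := by
    simp only [sampleSum]
    rw [integral_div, integral_finsetSum _ fun m _ => (hε m).integrable p.2,
      Finset.sum_eq_zero fun m _ => (hε m).integral_eq p.2, zero_div, Pi.zero_apply]
  crossCov_eq := by
    have hcov (m m' : ℕ) (j j' : Fin M) : cov[fun ω => ε m ω j, fun ω => ε m' ω j'; P] =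
        if m = m' then σ ^ 2 * (1 : Matrix (Fin M) (Fin M) ℝ) j j' else 0 := by
      split_ifs with hm
      · subst hm
        exact (hε m).covariance_eq j j'
      · exact congr_fun₂ (hεε hm) j j'
    refine Matrix.ext fun ⟨v, j⟩ ⟨v', j'⟩ => ?_
    simp only [crossCov, of_apply, sampleSum]
    rw [covariance_fun_div_left, covariance_fun_div_right, covariance_fun_sum_fun_sum'
      (fun m _ => (hε m).memLp j) (fun m _ => (hε m).memLp j')]
    simp only [hcov, Finset.sum_ite_eq, samplePrecision, kroneckerMap_apply]
    rcases eq_or_ne v v' with rfl | hv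
    · rw [diagonal_apply_eq, sampleCount, Finset.sum_congr rfl fun m hm => if_pos hm,
        Finset.sum_const, nsmul_eq_mul]
      field_simp
    · rw [diagonal_apply_ne _ hv, zero_mul, Finset.sum_eq_zero fun m hm => if_neg fun hm' =>
        hv ((Finset.mem_filter.mp hm).2.symm.trans (Finset.mem_filter.mp hm').2), zero_div,
        zero_div]

theorem crossCov_sampleSum_eq_zero [IsFiniteMeasure P] {ι : Type*} {ε : ℕ → Ω → Fin M → ℝ}
    {Y : Ω → ι → ℝ} (hY : ∀ i, MemLp (fun ω => Y ω i) 2 P)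
    (hε : ∀ k j, MemLp (fun ω => ε k ω j) 2 P) (hYε : ∀ k, crossCov Y (ε k) P = 0) (σ : ℝ)
    (s : ℕ → V) (k : ℕ) : crossCov Y (fun ω => sampleSum σ s (ε · ω) k) P = 0 := by
  have hcov (m : ℕ) (i : ι) (j : Fin M) : cov[fun ω => Y ω i, fun ω => ε m ω j; P] = 0 :=
    congr_fun₂ (hYε m) i j
  refine Matrix.ext fun i p => ?_
  simp only [crossCov, of_apply, sampleSum]
  rw [covariance_fun_div_right, covariance_fun_sum_right' (fun m _ => hε m _) (hY i)]
  simp only [hcov, Finset.sum_const_zero, zero_div, Matrix.zero_apply]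

theorem hasMeanCov_sub_postMean [IsProbabilityMeasure P] [Fintype V] {σ : ℝ} (hσ : σ ≠ 0)
    {Φ : Ω → V × Fin M → ℝ} {μ₀ : V × Fin M → ℝ} {S : Matrix (V × Fin M) (V × Fin M) ℝ}
    (hΦ : HasMeanCov Φ μ₀ S P) {ε : ℕ → Ω → Fin M → ℝ}
    (hε : ∀ k, HasMeanCov (ε k) 0 (σ ^ 2 • (1 : Matrix (Fin M) (Fin M) ℝ)) P)
    (hεε : Pairwise fun k k' => crossCov (ε k) (ε k') P = 0)
    (hΦε : ∀ k, crossCov Φ (ε k) P = 0) (s : ℕ → V) (k : ℕ) :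
    HasMeanCov (fun ω => Φ ω - postMean μ₀ S σ s (fun m j => Φ ω (s m, j) + ε m ω j) k) 0
      (postCov S σ s k) P := by
  have herr := hΦ.sub_posterior (hasMeanCov_sampleSum hσ hε hεε s k)
    (crossCov_sampleSum_eq_zero hΦ.memLp (fun k => (hε k).memLp) hΦε σ s k)
  simp only [← sampleSum_add] at herr
  exact herr

end PosteriorError

end GaussianPosterior

/-- Every robot communicates at least once in any `u` consecutive slots. -/
def CommunicatesWithin {N : ℕ} (u : ℕ) (comm : ℕ → Option (Fin N)) : Prop :=
  ∀ i t, ∃ t', t < t' ∧ t' ≤ t + u ∧ comm t' = some i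

namespace Environment

variable {V : Type*} [Fintype V] [DecidableEq V] {N M : ℕ} {env : Environment V N M}

/-- No single robot can decrease `H_inf` by moving. -/
def IsStable (env : Environment V N M) (Φ : Demand V M) (η : Config V N) : Prop :=
  ∀ i x, env.costInf Φ η ≤ env.costInf Φ (Function.update η i x)

/-- Between the times `t₀` and `t₁` the team runs the coverage algorithm with the demand `Φ`. As in
`DSMLCRun`, the step from time `t` to time `t + 1` is driven by the communication in slot
`t + 1`. -/
def FMCRun (tb : env.TieBreak) (Φ : Demand V M) (comm : ℕ → Option (Fin N)) (η : ℕ → Config V N)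
    (P : ℕ → Coverings V N M) (t₀ t₁ : ℕ) : Prop :=
  ∀ t, t₀ ≤ t → t < t₁ → FMCStep tb Φ (comm (t + 1)) (η t) (P t) (η (t + 1)) (P (t + 1))

variable {tb : env.TieBreak} {Φ : Demand V M}

section Step

variable {c : Option (Fin N)} {η η' : Config V N} {P P' : Coverings V N M}

theorem FMCStep.eq_or_costInf_lt (h : FMCStep tb Φ c η P η' P') :
    η' = η ∨ env.costInf Φ η' < env.costInf Φ η := by
  cases c with
  | none => exact .inl (h.1 rfl).1
  | some i =>
    obtain ⟨⟨x, rfl, -, hx⟩, -⟩ := h.2 i rfl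
    refine (lt_or_ge _ _).symm.imp_left fun hle => ?_
    rw [hx hle, Function.update_eq_self]

theorem FMCStep.eq_of_isStable (h : FMCStep tb Φ c η P η' P') (hη : env.IsStable Φ η) :
    η' = η := by
  cases c with
  | none => exact (h.1 rfl).1
  | some i =>
    obtain ⟨⟨x, rfl, -, hx⟩, -⟩ := h.2 i rfl
    rw [hx (hη i x), Function.update_eq_self]

theorem FMCStep.mem_best (h : FMCStep tb Φ c η P η' P') {j : Fin M} {v : V}
    (hv : v ∈ P j (tb.best η' j v) ∨ c = some (tb.best η' j v)) : v ∈ P' j (tb.best η' j v) := by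
  cases c with
  | none => simpa only [(h.1 rfl).2, reduceCtorEq, or_false] using hv
  | some i =>
    rw [(h.2 i rfl).2 j]
    by_cases hi : tb.best η' j v = i
    · rw [hi, Function.update_self]
      exact Finset.mem_union_right _ (Finset.mem_filter.mpr ⟨Finset.mem_univ v, hi⟩)
    · rw [Function.update_of_ne hi]
      exact hv.resolve_right fun h => hi (Option.some.inj h).symm

theorem FMCStep.best_eq_of_mem (h : FMCStep tb Φ c η P η' P') {j : Fin M} {v : V} {i : Fin N}
    (hbest : v ∈ P j (tb.best η' j v)) (hi : (v ∈ P j i → tb.best η' j v = i) ∨ c = some i)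
    (hv : v ∈ P' j i) : tb.best η' j v = i := by
  cases c with
  | none =>
    rw [(h.1 rfl).2] at hv
    exact hi.resolve_right (Option.some_ne_none i).symm hv
  | some k =>
    rw [(h.2 k rfl).2 j] at hv
    by_cases hik : i = k
    · subst hik
      by_contra hne
      rw [Function.update_self, Finset.mem_union, Finset.mem_sdiff] at hv
      rcases hv with ⟨hvi, hnot_loss⟩ | hgain
      · exact hnot_loss (Finset.mem_filter.mpr ⟨hvi, ⟨_, hne, hbest⟩, hne⟩)
      · exact hne (Finset.mem_filter.mp hgain).2
    · rw [Function.update_of_ne hik] at hv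
      exact hi.resolve_right (fun h => hik (Option.some.inj h).symm) hv

end Step

namespace FMCRun

variable {comm : ℕ → Option (Fin N)} {η : ℕ → Config V N} {P : ℕ → Coverings V N M}
  {t₀ t₁ u : ℕ}

theorem mono (h : FMCRun tb Φ comm η P t₀ t₁) {s₀ s₁ : ℕ} (h₀ : t₀ ≤ s₀) (h₁ : s₁ ≤ t₁) :
    FMCRun tb Φ comm η P s₀ s₁ :=
  fun t ht₀ ht₁ => h t (h₀.trans ht₀) (ht₁.trans_le h₁)

theorem eq_or_costInf_lt (h : FMCRun tb Φ comm η P t₀ t₁) (ht : t₀ ≤ t₁) :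
    η t₁ = η t₀ ∨ env.costInf Φ (η t₁) < env.costInf Φ (η t₀) := by
  induction t₁, ht using Nat.le_induction with
  | base => exact .inl rfl
  | succ t ht ih =>
    have ih := ih (h.mono le_rfl t.le_succ)
    rcases (h t ht t.lt_succ_self).eq_or_costInf_lt with heq | hlt
    · rwa [heq]
    · refine .inr ?_
      rcases ih with heq' | hlt'
      · rwa [← heq']
      · exact hlt.trans hlt'

theorem eq_of_isStable (h : FMCRun tb Φ comm η P t₀ t₁) (hst : env.IsStable Φ (η t₀))
    (ht : t₀ ≤ t₁) : η t₁ = η t₀ := by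
  induction t₁, ht using Nat.le_induction with
  | base => rfl
  | succ t ht ih =>
    have ih := ih (h.mono le_rfl t.le_succ)
    exact ((h t ht t.lt_succ_self).eq_of_isStable (ih ▸ hst)).trans ih

theorem isStable_of_forall_eq (h : FMCRun tb Φ comm η P t₀ (t₀ + u))
    (hcomm : CommunicatesWithin u comm) (hη : ∀ t, t₀ ≤ t → t ≤ t₀ + u → η t = η t₀) :
    env.IsStable Φ (η t₀) := by
  intro i x
  obtain ⟨t', hlt, hle, hi⟩ := hcomm i t₀
  obtain ⟨t, rfl⟩ := Nat.exists_eq_succ_of_ne_zero (Nat.ne_zero_of_lt hlt)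
  obtain ⟨⟨y, hy, hmin, -⟩, -⟩ := (h t (by omega) (by omega)).2 i hi
  rw [hη (t + 1) (by omega) hle, hη t (by omega) (by omega)] at hy
  rw [hη t (by omega) (by omega), ← hy] at hmin
  exact hmin x

theorem isStable_or_costInf_lt (h : FMCRun tb Φ comm η P t₀ (t₀ + u))
    (hcomm : CommunicatesWithin u comm) :
    env.IsStable Φ (η t₀) ∨ env.costInf Φ (η (t₀ + u)) < env.costInf Φ (η t₀) := by
  refine or_iff_not_imp_right.mpr fun hnot_lt => h.isStable_of_forall_eq hcomm fun t ht₀ ht₁ => ?_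
  refine ((h.mono le_rfl ht₁).eq_or_costInf_lt ht₀).resolve_right fun hlt => hnot_lt ?_
  rcases (h.mono ht₀ le_rfl).eq_or_costInf_lt ht₁ with heq | hlt'
  · rwa [heq]
  · exact hlt'.trans hlt

theorem isStable_of_card_lt (n : ℕ) (h : FMCRun tb Φ comm η P t₀ (t₀ + n * u))
    (hcomm : CommunicatesWithin u comm)
    (hn : (Finset.univ.filter fun e => env.costInf Φ e < env.costInf Φ (η t₀)).card < n) :
    env.IsStable Φ (η (t₀ + n * u)) := by
  induction n generalizing t₀ with
  | zero => exact absurd hn (Nat.not_lt_zero _)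
  | succ n ih =>
    have hend : t₀ + (n + 1) * u = t₀ + u + n * u := by ring
    rcases (h.mono le_rfl (by omega : t₀ + u ≤ _)).isStable_or_costInf_lt hcomm with hst | hlt
    · rwa [h.eq_of_isStable hst (Nat.le_add_right _ _)]
    · rw [hend] at h ⊢
      refine ih (h.mono (Nat.le_add_right _ _) le_rfl)
        ((Finset.card_lt_card ?_).trans_le (Nat.lt_succ_iff.mp hn))
      refine (Finset.ssubset_iff_of_subset fun e he => ?_).mpr
        ⟨η (t₀ + u), Finset.mem_filter.mpr ⟨Finset.mem_univ _, hlt⟩,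
          fun hmem => lt_irrefl _ (Finset.mem_filter.mp hmem).2⟩
      exact Finset.mem_filter.mpr ⟨Finset.mem_univ e, (Finset.mem_filter.mp he).2.trans hlt⟩

theorem isStable (h : FMCRun tb Φ comm η P t₀ t₁) (hcomm : CommunicatesWithin u comm)
    (ht : t₀ + Fintype.card (Config V N) * u ≤ t₁) :
    env.IsStable Φ (η (t₀ + Fintype.card (Config V N) * u)) :=
  (h.mono le_rfl ht).isStable_of_card_lt _ hcomm <| Finset.card_lt_univ_of_notMem
    fun hmem : η t₀ ∈ _ => lt_irrefl _ (Finset.mem_filter.mp hmem).2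

theorem mem_best_of_isStable (h : FMCRun tb Φ comm η P t₀ t₁) (hcomm : CommunicatesWithin u comm)
    (hst : env.IsStable Φ (η t₀)) (ht : t₀ + u ≤ t₁) (j : Fin M) (v : V) :
    v ∈ P t₁ j (tb.best (η t₀) j v) := by
  obtain ⟨t', hlt, hle, hi⟩ := hcomm (tb.best (η t₀) j v) t₀
  replace hle := hle.trans ht
  clear ht
  induction t₁, hle using Nat.le_induction with
  | base =>
    obtain ⟨t, rfl⟩ := Nat.exists_eq_succ_of_ne_zero (Nat.ne_zero_of_lt hlt)
    have hmem := (h t (by omega) t.lt_succ_self).mem_best (j := j) (v := v)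
    rw [h.eq_of_isStable hst (by omega)] at hmem
    exact hmem (.inr hi)
  | succ t htt' ih =>
    have hmem := (h t (by omega) t.lt_succ_self).mem_best (j := j) (v := v)
    rw [h.eq_of_isStable hst (by omega)] at hmem
    exact hmem (.inl (ih (h.mono le_rfl t.le_succ)))

theorem best_eq_of_mem_of_isStable (h : FMCRun tb Φ comm η P t₀ t₁)
    (hcomm : CommunicatesWithin u comm) (hst : env.IsStable Φ (η t₀)) (ht : t₀ + 2 * u ≤ t₁)
    {i : Fin N} {j : Fin M} {v : V} (hv : v ∈ P t₁ j i) : tb.best (η t₀) j v = i := by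
  obtain ⟨t', hlt, hle, hi⟩ := hcomm i (t₀ + u)
  replace hle : t' ≤ t₁ := by omega
  clear ht
  induction t₁, hle using Nat.le_induction with
  | base =>
    obtain ⟨t, rfl⟩ := Nat.exists_eq_succ_of_ne_zero (Nat.ne_zero_of_lt hlt)
    have hbest := (h.mono le_rfl t.le_succ).mem_best_of_isStable hcomm hst (by omega) j v
    have heq := (h t (by omega) t.lt_succ_self).best_eq_of_mem (j := j) (v := v) (i := i)
    rw [h.eq_of_isStable hst (by omega)] at heq
    exact heq hbest (.inr hi) hv
  | succ t htt' ih =>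
    have hrun := h.mono le_rfl t.le_succ
    have hbest := hrun.mem_best_of_isStable hcomm hst (by omega) j v
    have heq := (h t (by omega) t.lt_succ_self).best_eq_of_mem (j := j) (v := v) (i := i)
    rw [h.eq_of_isStable hst (by omega)] at heq
    exact heq hbest (.inl (ih hrun)) hv

theorem eq_equitable_of_isStable (h : FMCRun tb Φ comm η P t₀ t₁)
    (hcomm : CommunicatesWithin u comm) (hst : env.IsStable Φ (η t₀)) (ht : t₀ + 2 * u ≤ t₁) :
    P t₁ = equitable tb (η t₁) := by
  rw [h.eq_of_isStable hst (by omega)]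
  funext j i
  ext v
  rw [equitable, Finset.mem_filter, and_iff_right (Finset.mem_univ v)]
  exact ⟨h.best_eq_of_mem_of_isStable hcomm hst ht,
    fun hv => hv ▸ h.mem_best_of_isStable hcomm hst (by omega) j v⟩

theorem isStable_and_eq_equitable (h : FMCRun tb Φ comm η P t₀ t₁)
    (hcomm : CommunicatesWithin u comm) (ht : t₀ + (Fintype.card (Config V N) + 2) * u ≤ t₁) :
    env.IsStable Φ (η t₁) ∧ P t₁ = equitable tb (η t₁) := by
  rw [add_mul, ← add_assoc] at ht
  have hst := h.isStable hcomm (by omega)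
  have htail := h.mono (Nat.le_add_right t₀ (Fintype.card (Config V N) * u)) le_rfl
  refine ⟨?_, htail.eq_equitable_of_isStable hcomm hst ht⟩
  rwa [htail.eq_of_isStable hst (by omega)]

end FMCRun

end Environment

/-- The `ℓ¹` norm of a demand, in which its estimation error is measured. -/
def demandNorm {V : Type*} [Fintype V] {M : ℕ} (Φ : Demand V M) : ℝ := ∑ j, ∑ v, |Φ v j|

theorem demandNorm_nonneg {V : Type*} [Fintype V] {M : ℕ} (Φ : Demand V M) : 0 ≤ demandNorm Φ :=
  Finset.sum_nonneg fun _ _ => Finset.sum_nonneg fun _ _ => abs_nonneg _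

namespace Environment

section Cost

variable {V : Type*} {N M : ℕ} {env : Environment V N M} {Φ Φ' : Demand V M} {B : ℝ}

theorem cost_eq_sum_robotCost (Φ : Demand V M) (η : Config V N) (P : Coverings V N M) :
    env.cost Φ η P = ∑ i, env.robotCost Φ P i (η i) :=
  Finset.sum_comm

theorem isCenters_centers [Finite V] (Φ : Demand V M) (P : Coverings V N M) :
    env.IsCenters Φ P (env.centers Φ P) :=
  (env.exists_isCenters Φ P).choose_spec

theorem exists_abs_service_le [Finite V] (env : Environment V N M) :
    ∃ B, 0 ≤ B ∧ ∀ i j x v, |env.service i j x v| ≤ B := by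
  obtain ⟨B, hB⟩ := Finite.bddAbove_range
    fun p : Fin N × Fin M × V × V => |env.service p.1 p.2.1 p.2.2.1 p.2.2.2|
  exact ⟨max B 0, le_max_right _ _, fun i j x v =>
    (hB (Set.mem_range_self (i, j, x, v))).trans (le_max_left _ _)⟩

theorem iInf_service_eq (tb : env.TieBreak) (η : Config V N) (j : Fin M) (v : V) :
    ⨅ i, env.service i j (η i) v = env.service (tb.best η j v) j (η (tb.best η j v)) v :=
  have : Nonempty (Fin N) := ⟨tb.best η j v⟩
  le_antisymm (ciInf_le (Set.finite_range _).bddBelow _) (le_ciInf (tb.best_le η j v))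

theorem cost_update_sub_cost (Φ : Demand V M) (η : Config V N) (P : Coverings V N M) (i : Fin N)
    (x : V) : env.cost Φ (Function.update η i x) P - env.cost Φ η P =
      env.robotCost Φ P i x - env.robotCost Φ P i (η i) := by
  rw [cost_eq_sum_robotCost, cost_eq_sum_robotCost, ← Finset.sum_sub_distrib,
    Fintype.sum_eq_single i fun k hk => by rw [Function.update_of_ne hk, sub_self],
    Function.update_self]

variable [Fintype V]

theorem abs_robotCost_le (hB : ∀ i j x v, |env.service i j x v| ≤ B) (Φ : Demand V M)
    (P : Coverings V N M) (i : Fin N) (x : V) : |env.robotCost Φ P i x| ≤ B * demandNorm Φ := by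
  rw [demandNorm, Finset.mul_sum]
  refine (Finset.abs_sum_le_sum_abs _ _).trans (Finset.sum_le_sum fun j _ => ?_)
  calc |∑ v ∈ P j i, env.service i j x v * Φ v j|
      ≤ ∑ v ∈ P j i, |env.service i j x v * Φ v j| := Finset.abs_sum_le_sum_abs _ _
    _ ≤ ∑ v, |env.service i j x v * Φ v j| :=
      Finset.sum_le_univ_sum_of_nonneg fun _ => abs_nonneg _
    _ ≤ B * ∑ v, |Φ v j| := by
      rw [Finset.mul_sum]
      refine Finset.sum_le_sum fun v _ => ?_
      rw [abs_mul]
      exact mul_le_mul_of_nonneg_right (hB i j x v) (abs_nonneg _)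

theorem abs_cost_le (hB : ∀ i j x v, |env.service i j x v| ≤ B) (Φ : Demand V M)
    (η : Config V N) (P : Coverings V N M) : |env.cost Φ η P| ≤ N * (B * demandNorm Φ) := by
  rw [cost_eq_sum_robotCost]
  refine (Finset.abs_sum_le_sum_abs _ _).trans ?_
  refine (Finset.sum_le_card_nsmul _ _ _ fun i _ => abs_robotCost_le hB Φ P i (η i)).trans_eq ?_
  rw [Finset.card_univ, Fintype.card_fin, nsmul_eq_mul]

end Cost

section Equitable

variable {V : Type*} [Fintype V] {N M : ℕ} {env : Environment V N M} {Φ Φ' : Demand V M} {B : ℝ}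

theorem abs_regret_le (tb : env.TieBreak) (hB : ∀ i j x v, |env.service i j x v| ≤ B)
    (Φ : Demand V M) (η : Config V N) (P : Coverings V N M) :
    |regret tb Φ η P| ≤ 4 * (N * (B * demandNorm Φ)) := by
  have hcost := abs_le.mp (abs_cost_le hB Φ η P)
  have hcenters := abs_le.mp (abs_cost_le hB Φ (env.centers Φ P) P)
  have hequitable := abs_le.mp (abs_cost_le hB Φ η (equitable tb η))
  rw [regret, abs_le]
  constructor <;> linarith

theorem cost_equitable (tb : env.TieBreak) (Φ : Demand V M) (η η' : Config V N) :
    env.cost Φ η' (equitable tb η) =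
      ∑ j, ∑ v, env.service (tb.best η j v) j (η' (tb.best η j v)) v * Φ v j := by
  refine Finset.sum_congr rfl fun j _ => ?_
  rw [← Finset.sum_fiberwise Finset.univ (tb.best η j)]
  exact Finset.sum_congr rfl fun i _ => Finset.sum_congr rfl fun v hv => by
    rw [(Finset.mem_filter.mp hv).2]

theorem cost_equitable_self (tb : env.TieBreak) (Φ : Demand V M) (η : Config V N) :
    env.cost Φ η (equitable tb η) = env.costInf Φ η := by
  simp only [cost_equitable, costInf, iInf_service_eq tb]

theorem costInf_le_cost_equitable (tb : env.TieBreak) (hΦ : ∀ v j, 0 ≤ Φ v j)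
    (η η' : Config V N) : env.costInf Φ η' ≤ env.cost Φ η' (equitable tb η) := by
  rw [cost_equitable]
  exact Finset.sum_le_sum fun j _ => Finset.sum_le_sum fun v _ =>
    mul_le_mul_of_nonneg_right (ciInf_le (Set.finite_range _).bddBelow _) (hΦ v j)

theorem abs_costInf_sub_costInf_le (tb : env.TieBreak)
    (hB : ∀ i j x v, |env.service i j x v| ≤ B) (Φ Φ' : Demand V M) (η : Config V N) :
    |env.costInf Φ η - env.costInf Φ' η| ≤ B * demandNorm (Φ - Φ') := by
  simp only [costInf, iInf_service_eq tb, ← Finset.sum_sub_distrib, ← mul_sub, demandNorm,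
    Finset.mul_sum]
  refine (Finset.abs_sum_le_sum_abs _ _).trans (Finset.sum_le_sum fun j _ => ?_)
  refine (Finset.abs_sum_le_sum_abs _ _).trans (Finset.sum_le_sum fun v _ => ?_)
  rw [abs_mul]
  exact mul_le_mul_of_nonneg_right (hB _ _ _ _) (abs_nonneg _)

theorem costInf_sub_costInf_update_le (tb : env.TieBreak)
    (hB : ∀ i j x v, |env.service i j x v| ≤ B) {η : Config V N} (hst : env.IsStable Φ' η)
    (i : Fin N) (x : V) :
    env.costInf Φ η - env.costInf Φ (Function.update η i x) ≤
      2 * (B * demandNorm (Φ - Φ')) := by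
  have hη := abs_le.mp (abs_costInf_sub_costInf_le tb hB Φ Φ' η)
  have hηx := abs_le.mp (abs_costInf_sub_costInf_le tb hB Φ Φ' (Function.update η i x))
  linarith [hst i x]

theorem regret_equitable (tb : env.TieBreak) (Φ : Demand V M) (η : Config V N) :
    regret tb Φ η (equitable tb η) = ∑ i, (env.robotCost Φ (equitable tb η) i (η i) -
      env.robotCost Φ (equitable tb η) i (env.centers Φ (equitable tb η) i)) := by
  rw [regret, Finset.sum_sub_distrib, ← cost_eq_sum_robotCost,
    ← cost_eq_sum_robotCost Φ (env.centers Φ _)]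
  ring

theorem abs_regret_le_of_isStable (tb : env.TieBreak)
    (hB : ∀ i j x v, |env.service i j x v| ≤ B) (hΦ : ∀ v j, 0 ≤ Φ v j) {η : Config V N}
    (hst : env.IsStable Φ' η) :
    |regret tb Φ η (equitable tb η)| ≤ N * (2 * (B * demandNorm (Φ - Φ'))) := by
  have hrobot (i : Fin N) (x : V) : env.robotCost Φ (equitable tb η) i (η i) -
      env.robotCost Φ (equitable tb η) i x ≤ 2 * (B * demandNorm (Φ - Φ')) := by
    calc
      _ = env.cost Φ η (equitable tb η) -
          env.cost Φ (Function.update η i x) (equitable tb η) := by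
        linarith [cost_update_sub_cost (env := env) Φ η (equitable tb η) i x]
      _ ≤ env.costInf Φ η - env.costInf Φ (Function.update η i x) := by
        rw [cost_equitable_self]
        exact sub_le_sub_left (costInf_le_cost_equitable tb hΦ _ _) _
      _ ≤ _ := costInf_sub_costInf_update_le tb hB hst i x
  rw [regret_equitable, abs_of_nonneg (Finset.sum_nonneg fun i _ =>
    sub_nonneg.mpr (isCenters_centers Φ _ i (η i)))]
  refine (Finset.sum_le_card_nsmul _ _ _ fun i _ => hrobot i _).trans_eq ?_
  rw [Finset.card_univ, Fintype.card_fin, nsmul_eq_mul]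

/-- The regret is at most `C` times the norm of the demand, and at most `C` times the estimation
error once the coverage algorithm has converged for the estimate `Φ'`. -/
structure IsRegretConst (tb : env.TieBreak) (C : ℝ) : Prop where
  nonneg : 0 ≤ C
  abs_regret_le (Φ : Demand V M) (η : Config V N) (P : Coverings V N M) :
    |regret tb Φ η P| ≤ C * demandNorm Φ
  abs_regret_equitable_le {Φ Φ' : Demand V M} {η : Config V N} (hΦ : ∀ v j, 0 ≤ Φ v j)
    (hst : env.IsStable Φ' η) : |regret tb Φ η (equitable tb η)| ≤ C * demandNorm (Φ - Φ')

theorem exists_isRegretConst (tb : env.TieBreak) : ∃ C, IsRegretConst tb C := by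
  obtain ⟨B, hB₀, hB⟩ := env.exists_abs_service_le
  refine ⟨4 * (N * B), by positivity, fun Φ η P => ?_, fun {Φ Φ' η} hΦ hst => ?_⟩
  · exact (abs_regret_le tb hB Φ η P).trans_eq (by ring)
  · have hnorm : 0 ≤ N * (B * demandNorm (Φ - Φ')) := by
      have := demandNorm_nonneg (Φ - Φ')
      positivity
    linarith [abs_regret_le_of_isStable tb hB hΦ hst]

end Equitable

end Environment

theorem sum_Ioc_le_of_le_of_late_le {g : ℕ → ℝ} {x y z : ℕ} {a b : ℝ} (ha : 0 ≤ a) (hxy : x ≤ y)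
    (hga : ∀ t, g t ≤ a) (hgb : ∀ t, y ≤ t → t ≤ z → g t ≤ b) :
    ∑ t ∈ Finset.Ioc x z, g t ≤ (y - x : ℕ) * a + (z - y : ℕ) * b := by
  have hsum (x z : ℕ) (c : ℝ) (hc : ∀ t ∈ Finset.Ioc x z, g t ≤ c) :
      ∑ t ∈ Finset.Ioc x z, g t ≤ (z - x : ℕ) * c := by
    simpa only [Nat.card_Ioc, nsmul_eq_mul] using Finset.sum_le_card_nsmul _ _ _ hc
  rcases le_total y z with hyz | hzy
  · rw [← Finset.sum_Ioc_consecutive g hxy hyz]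
    refine add_le_add (hsum x y a fun t _ => hga t) (hsum y z b fun t ht => ?_)
    exact hgb t (Finset.mem_Ioc.mp ht).1.le (Finset.mem_Ioc.mp ht).2
  · rw [Nat.sub_eq_zero_of_le hzy, Nat.cast_zero, zero_mul, add_zero]
    exact (hsum x z a fun t _ => hga t).trans (by gcongr)

/-- A bound for the number of slots between the end of the exploration of an epoch and the
convergence of its coverage algorithm: `u` slots of information propagation, and those of
`Environment.FMCRun.isStable_and_eq_equitable`. -/
def settlingTime (V : Type*) [Fintype V] (N u : ℕ) : ℕ :=
  u + (Fintype.card (Config V N) + 2) * u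

/-- Up to the constant of `Environment.IsRegretConst`, a bound for the regret of the first `L`
epochs: in the slots of exploration and in at most `κ` further slots per epoch the regret is bounded
by the norm of the demand, and in the remaining slots by the error of the current estimate. -/
noncomputable def regretMajorant {V : Type*} [Fintype V] {M : ℕ} (ρ κ : ℕ) (β : ℝ) (n : ℕ → ℕ)
    (est : ℕ → Demand V M) (Φ : Demand V M) (L : ℕ) : ℝ :=
  (ρ * n L + L * κ) * demandNorm Φ +
    ∑ ℓ ∈ Finset.range L, ⌈β ^ (ℓ + 1)⌉₊ * demandNorm (Φ - est (ℓ + 1))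

theorem regretMajorant_nonneg {V : Type*} [Fintype V] {M : ℕ} (ρ κ : ℕ) (β : ℝ) (n : ℕ → ℕ)
    (est : ℕ → Demand V M) (Φ : Demand V M) (L : ℕ) : 0 ≤ regretMajorant ρ κ β n est Φ L :=
  add_nonneg (mul_nonneg (by positivity) (demandNorm_nonneg Φ)) <|
    Finset.sum_nonneg fun _ _ => mul_nonneg (Nat.cast_nonneg _) (demandNorm_nonneg _)

theorem IsFederated.communicatesWithin {N : ℕ} {l u : ℕ} {comm : ℕ → Option (Fin N)}
    (h : IsFederated l u comm) : CommunicatesWithin u comm :=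
  h.gap_le

namespace DSMLCRun

variable {V : Type*} [Fintype V] [DecidableEq V] {N M : ℕ} {env : Environment V N M}
  {tb : env.TieBreak} {l u ρ : ℕ} {β : ℝ} {s : ℕ → V} {n : ℕ → ℕ} {est : ℕ → Demand V M}

theorem tCov_le (r : DSMLCRun tb l u ρ β s n est) (ℓ : ℕ) :
    r.tCov ℓ ≤ r.tExp ℓ + ρ * (n (ℓ + 1) - n ℓ) + u := by
  have hcomm : r.tCov ℓ ≤ r.tInf ℓ + u := (r.tCov_isLeast ℓ).2
    ⟨Nat.le_add_right _ _, fun i => r.comm_federated.gap_le i (r.tInf ℓ)⟩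
  exact hcomm.trans (Nat.add_le_add_right (r.tInf_le ℓ) u)

theorem tExp_le_tCov (r : DSMLCRun tb l u ρ β s n est) (ℓ : ℕ) : r.tExp ℓ ≤ r.tCov ℓ :=
  (r.tExp_le_tInf ℓ).trans (r.tCov_isLeast ℓ).1.1

theorem pow_le_tExp (r : DSMLCRun tb l u ρ β s n est) {L : ℕ} (hL : L ≠ 0) :
    β ^ L ≤ r.tExp L := by
  obtain ⟨ℓ, rfl⟩ := Nat.exists_eq_succ_of_ne_zero hL
  rw [Nat.succ_eq_add_one, r.tExp_succ, Nat.cast_add]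
  exact (Nat.le_ceil _).trans (le_add_of_nonneg_left (Nat.cast_nonneg _))

theorem sum_abs_regret_epoch_le (r : DSMLCRun tb l u ρ β s n est) {C : ℝ}
    (hC : Environment.IsRegretConst tb C) {Φ : Demand V M} (hΦ : ∀ v j, 0 ≤ Φ v j) (ℓ : ℕ) :
    ∑ t ∈ Finset.Ioc (r.tExp ℓ) (r.tExp (ℓ + 1)), |Environment.regret tb Φ (r.η t) (r.P t)| ≤
      (ρ * (n (ℓ + 1) - n ℓ) + settlingTime V N u : ℕ) * (C * demandNorm Φ) +
        ⌈β ^ (ℓ + 1)⌉₊ * (C * demandNorm (Φ - est (ℓ + 1))) := by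
  have hC₀ := hC.nonneg
  have hΦ₀ := demandNorm_nonneg Φ
  have herr₀ := demandNorm_nonneg (Φ - est (ℓ + 1))
  have htCov := r.tCov_le ℓ
  refine (sum_Ioc_le_of_le_of_late_le (y := r.tCov ℓ + (Fintype.card (Config V N) + 2) * u)
    (b := C * demandNorm (Φ - est (ℓ + 1))) (by positivity)
    ((r.tExp_le_tCov ℓ).trans (Nat.le_add_right _ _)) (fun t => hC.abs_regret_le Φ _ _)
    fun t ht₀ ht₁ => ?_).trans ?_
  · have hrun : Environment.FMCRun tb (est (ℓ + 1)) r.comm r.η r.P (r.tCov ℓ) (r.tExp (ℓ + 1)) :=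
      r.coverage_step ℓ
    obtain ⟨hst, hP⟩ := (hrun.mono le_rfl ht₁).isStable_and_eq_equitable
      r.comm_federated.communicatesWithin ht₀
    rw [hP]
    exact hC.abs_regret_equitable_le hΦ hst
  · rw [r.tExp_succ]
    gcongr
    · unfold settlingTime
      omega
    · omega

theorem sum_abs_regret_le (r : DSMLCRun tb l u ρ β s n est) {C : ℝ}
    (hC : Environment.IsRegretConst tb C) {Φ : Demand V M} (hΦ : ∀ v j, 0 ≤ Φ v j)
    (hn : Monotone n) (L : ℕ) :
    ∑ t ∈ Finset.Ioc 0 (r.tExp L), |Environment.regret tb Φ (r.η t) (r.P t)| ≤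
      C * regretMajorant ρ (settlingTime V N u) β n est Φ L := by
  induction L with
  | zero =>
    rw [r.tExp_zero, Finset.Ioc_self, Finset.sum_empty]
    exact mul_nonneg hC.nonneg (regretMajorant_nonneg _ _ _ _ _ _ _)
  | succ L ih =>
    have htExp : r.tExp L ≤ r.tExp (L + 1) := by
      rw [r.tExp_succ]
      exact (r.tExp_le_tCov L).trans (Nat.le_add_right _ _)
    have hepoch := r.sum_abs_regret_epoch_le hC hΦ L
    rw [← Finset.sum_Ioc_consecutive _ (Nat.zero_le _) htExp]
    refine (add_le_add ih hepoch).trans_eq ?_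
    push_cast [regretMajorant, Finset.sum_range_succ, hn L.le_succ]
    ring

theorem abs_sum_regret_le (r : DSMLCRun tb l u ρ β s n est) {C : ℝ}
    (hC : Environment.IsRegretConst tb C) {Φ : Demand V M} (hΦ : ∀ v j, 0 ≤ Φ v j)
    (hn : Monotone n) {T L : ℕ} (hL : L ≠ 0) (hT : T ≤ β ^ L) :
    |∑ t ∈ Finset.Icc 1 T, Environment.regret tb Φ (r.η t) (r.P t)| ≤
      C * regretMajorant ρ (settlingTime V N u) β n est Φ L := by
  refine (Finset.abs_sum_le_sum_abs _ _).trans (le_trans ?_ (r.sum_abs_regret_le hC hΦ hn L))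
  refine Finset.sum_le_sum_of_subset_of_nonneg (fun t ht => ?_) fun _ _ _ => abs_nonneg _
  have hTL : T ≤ r.tExp L := Nat.cast_le.mp (hT.trans (r.pow_le_tExp hL))
  rw [Finset.mem_Icc] at ht
  exact Finset.mem_Ioc.mpr ⟨ht.1, ht.2.trans hTL⟩

end DSMLCRun

section Measurability

theorem aemeasurable_comp_of_countable {Ω ι E F : Type*} [MeasurableSpace Ω] [MeasurableSpace E]
    [MeasurableSpace F] [Countable ι] {μ : Measure Ω} {X : Ω → ι}
    (hX : ∀ i, MeasurableSet {ω | X ω = i}) {f : ι → E → F} (hf : ∀ i, Measurable (f i))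
    {Y : Ω → E} (hY : AEMeasurable Y μ) : AEMeasurable (fun ω => f (X ω) (Y ω)) μ := by
  let _ : MeasurableSpace ι := ⊤
  have hf' : Measurable fun z : E × ι => f z.2 z.1 := measurable_from_prod_countable_left hf
  exact hf'.comp_aemeasurable (hY.prodMk (measurable_to_countable' hX).aemeasurable)

namespace Environment

variable {V : Type*} {N M : ℕ} {env : Environment V N M}

theorem continuous_robotCost (P : Coverings V N M) (i : Fin N) (x : V) :
    Continuous fun Φ : Demand V M => env.robotCost Φ P i x := by
  unfold robotCost
  fun_prop

theorem measurable_cost (η : Config V N) (P : Coverings V N M) :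
    Measurable fun Φ : Demand V M => env.cost Φ η P := by
  unfold cost
  fun_prop

theorem measurable_cost_centers [Finite V] (P : Coverings V N M) :
    Measurable fun Φ : Demand V M => env.cost Φ (env.centers Φ P) P := by
  have := Fintype.ofFinite V
  have := env.connected.nonempty
  have hcost (Φ : Demand V M) : env.cost Φ (env.centers Φ P) P =
      ∑ i, Finset.univ.inf' Finset.univ_nonempty (env.robotCost Φ P i) := by
    rw [cost_eq_sum_robotCost]
    refine Finset.sum_congr rfl fun i _ => le_antisymm ?_ ?_
    · exact Finset.le_inf' _ _ fun x _ => isCenters_centers Φ P i x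
    · exact Finset.inf'_le _ (Finset.mem_univ _)
  simp only [hcost]
  refine Finset.measurable_fun_sum _ fun i _ => Continuous.measurable ?_
  exact Continuous.finset_inf'_apply _ fun x _ => continuous_robotCost P i x

variable [Fintype V]

theorem measurable_regret (tb : env.TieBreak) (η : Config V N) (P : Coverings V N M) :
    Measurable fun Φ : Demand V M => regret tb Φ η P :=
  (((measurable_cost η P).const_mul 2).sub (measurable_cost_centers P)).sub (measurable_cost η _)

theorem aemeasurable_regret (tb : env.TieBreak) {Ω : Type*} [MeasurableSpace Ω] {μ : Measure Ω}
    {Φ : Ω → Demand V M} (hΦ : AEMeasurable Φ μ) {η : Ω → Config V N} {P : Ω → Coverings V N M}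
    (hηP : ∀ x p, MeasurableSet {ω | η ω = x ∧ P ω = p}) :
    AEMeasurable (fun ω => regret tb (Φ ω) (η ω) (P ω)) μ :=
  aemeasurable_comp_of_countable (X := fun ω => (η ω, P ω))
    (f := fun (z : Config V N × Coverings V N M) Φ => regret tb Φ z.1 z.2)
    (fun z => by simpa only [Prod.ext_iff] using hηP z.1 z.2)
    (fun z => measurable_regret tb z.1 z.2) hΦ

end Environment

end Measurability

section Conditioning

variable {Ω : Type*} [MeasurableSpace Ω] {P : Measure Ω} {A : Set Ω} {f g : Ω → ℝ}

theorem integrable_cond (hf : Integrable f P) (A : Set Ω) : Integrable f (cond P A) := by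
  rcases eq_or_ne (P A) 0 with hA | hA
  · rw [cond_eq_zero_of_meas_eq_zero hA]
    exact integrable_zero_measure
  · exact hf.restrict.smul_measure (ENNReal.inv_ne_top.mpr hA)

theorem integral_cond_le (hf : Integrable f P) (hf₀ : 0 ≤ f) (A : Set Ω) :
    ∫ ω, f ω ∂(cond P A) ≤ (P A)⁻¹.toReal * ∫ ω, f ω ∂P := by
  rw [ProbabilityTheory.cond, integral_smul_measure, smul_eq_mul]
  exact mul_le_mul_of_nonneg_left (setIntegral_le_integral hf (.of_forall hf₀))
    ENNReal.toReal_nonneg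

theorem integrable_cond_of_abs_le (hA : NullMeasurableSet A P) (hf : AEMeasurable f P)
    (hg : Integrable g P) (hfg : ∀ ω ∈ A, |f ω| ≤ g ω) : Integrable f (cond P A) :=
  (integrable_cond hg A).mono' (hf.mono_ac cond_absolutelyContinuous).aestronglyMeasurable
    ((ae_cond_mem₀ hA).mono hfg)

theorem abs_integral_cond_le (hA : NullMeasurableSet A P) (hg : Integrable g P) (hg₀ : 0 ≤ g)
    (hfg : ∀ ω ∈ A, |f ω| ≤ g ω) :
    |∫ ω, f ω ∂(cond P A)| ≤ (P A)⁻¹.toReal * ∫ ω, g ω ∂P := by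
  have hae : ∀ᵐ ω ∂(cond P A), ‖f ω‖ ≤ g ω := (ae_cond_mem₀ hA).mono hfg
  exact (norm_integral_le_of_norm_le (integrable_cond hg A) hae).trans
    (integral_cond_le hg hg₀ A)

end Conditioning

section Growth

theorem isBigO_rpow_of_abs_le_pow {β p C : ℝ} (hβ : 1 < β) (hp : 0 ≤ p) {f : ℕ → ℝ}
    (hf : ∀ T L : ℕ, L ≠ 0 → (T : ℝ) ≤ β ^ L → |f T| ≤ C * (β ^ p) ^ L) :
    f =O[Filter.atTop] fun T : ℕ => (T : ℝ) ^ p := by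
  have hβ₀ : 0 < β := one_pos.trans hβ
  have hC : 0 ≤ C := by
    have h := (abs_nonneg _).trans (hf 0 1 one_ne_zero (by simpa using hβ₀.le))
    exact nonneg_of_mul_nonneg_left h (by positivity)
  refine .of_bound (C * β ^ p) ?_
  filter_upwards [Filter.eventually_ge_atTop 1] with T hT
  obtain ⟨k, hk, hk'⟩ := exists_nat_pow_near (Nat.one_le_cast.mpr hT : (1 : ℝ) ≤ T) hβ
  rw [Real.norm_eq_abs, Real.norm_of_nonneg (by positivity)]
  calc |f T| ≤ C * (β ^ p) ^ (k + 1) := hf T (k + 1) k.succ_ne_zero hk'.le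
    _ = C * β ^ p * (β ^ k) ^ p := by rw [← Real.rpow_pow_comm hβ₀.le]; ring
    _ ≤ C * β ^ p * (T : ℝ) ^ p := by gcongr

theorem natCast_le_mul_pow {Q : ℝ} (hQ : 1 < Q) (L : ℕ) : (L : ℝ) ≤ (Q - 1)⁻¹ * Q ^ L := by
  rw [le_inv_mul_iff₀ (sub_pos.mpr hQ)]
  have hbernoulli := one_add_mul_le_pow (a := Q - 1) (by linarith) L
  rw [add_sub_cancel] at hbernoulli
  linarith

theorem sum_range_pow_succ_le {Q : ℝ} (hQ : 1 < Q) (L : ℕ) :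
    ∑ ℓ ∈ Finset.range L, Q ^ (ℓ + 1) ≤ Q * (Q - 1)⁻¹ * Q ^ L := by
  have : 0 < Q - 1 := sub_pos.mpr hQ
  simp only [pow_succ', ← Finset.mul_sum]
  rw [geom_sum_eq hQ.ne', div_eq_inv_mul, mul_assoc]
  gcongr
  exact sub_le_self _ zero_le_one

theorem mul_sqrt_rpow_neg_two_thirds {β : ℝ} (hβ : 0 < β) :
    β * √(β ^ (-(2 / 3) : ℝ)) = β ^ (2 / 3 : ℝ) := by
  rw [Real.sqrt_eq_rpow, ← Real.rpow_mul hβ.le, ← Real.rpow_one_add' hβ.le (by norm_num)]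
  norm_num

theorem ceil_pow_mul_sqrt_le {β : ℝ} (hβ : 1 ≤ β) (τ : ℝ) (ℓ : ℕ) :
    ⌈β ^ ℓ⌉₊ * √((β ^ (-(2 / 3) : ℝ)) ^ ℓ * τ) ≤ 2 * √τ * (β ^ (2 / 3 : ℝ)) ^ ℓ := by
  have hβ₀ : 0 < β := one_pos.trans_le hβ
  have hceil : (⌈β ^ ℓ⌉₊ : ℝ) ≤ 2 * β ^ ℓ :=
    Nat.ceil_le_two_mul ((by norm_num : (2⁻¹ : ℝ) ≤ 1).trans (one_le_pow₀ hβ))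
  rw [Real.sqrt_mul (by positivity), Real.sqrt_eq_rpow, ← Real.rpow_pow_comm (by positivity),
    ← Real.sqrt_eq_rpow, ← mul_sqrt_rpow_neg_two_thirds hβ₀, mul_pow]
  calc _ ≤ 2 * β ^ ℓ * (√(β ^ (-(2 / 3) : ℝ)) ^ ℓ * √τ) := by gcongr
    _ = _ := by ring

end Growth

section Moments

variable {Ω : Type*} [MeasurableSpace Ω] {P : Measure Ω}

theorem integral_abs_le_sqrt_integral_sq [IsProbabilityMeasure P] {f : Ω → ℝ} (hf : MemLp f 2 P) :
    ∫ ω, |f ω| ∂P ≤ √(∫ ω, f ω ^ 2 ∂P) := by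
  refine Real.le_sqrt_of_sq_le ?_
  have hvar := variance_nonneg |f| P
  rw [variance_eq_sub hf.abs] at hvar
  simpa only [Pi.pow_apply, Pi.abs_apply, sq_abs, sub_nonneg] using hvar

variable {V : Type*} [Fintype V] {M : ℕ} {X : Ω → V × Fin M → ℝ} {m : V × Fin M → ℝ}
  {C : Matrix (V × Fin M) (V × Fin M) ℝ}

theorem HasMeanCov.integrable_demandNorm [IsFiniteMeasure P] (hX : HasMeanCov X m C P) :
    Integrable (fun ω => demandNorm fun v j => X ω (v, j)) P :=
  integrable_finsetSum _ fun j _ => integrable_finsetSum _ fun v _ => (hX.integrable (v, j)).abs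

theorem HasMeanCov.integral_demandNorm_le [IsProbabilityMeasure P] (hX : HasMeanCov X 0 C P)
    {c : ℝ} (hc : ∀ v, (block C v).trace ≤ c) :
    ∫ ω, demandNorm (fun v j => X ω (v, j)) ∂P ≤ M * Fintype.card V * √c := by
  have hcoord (v : V) (j : Fin M) : ∫ ω, |X ω (v, j)| ∂P ≤ √c := by
    refine (integral_abs_le_sqrt_integral_sq (hX.memLp _)).trans (Real.sqrt_le_sqrt ?_)
    rw [hX.integral_sq_eq]
    exact (Finset.single_le_sum (f := fun j => C (v, j) (v, j))
      (fun _ _ => hX.posSemidef.diag_nonneg) (Finset.mem_univ j)).trans (hc v)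
  have hint (j : Fin M) (v : V) : Integrable (fun ω => |X ω (v, j)|) P := (hX.integrable _).abs
  simp only [demandNorm]
  rw [integral_finsetSum _ fun j _ => integrable_finsetSum _ fun v _ => hint j v]
  simp only [integral_finsetSum _ fun v _ => hint _ v]
  refine (Finset.sum_le_sum fun j _ => Finset.sum_le_sum fun v _ => hcoord v j).trans_eq ?_
  simp only [Finset.sum_const, Finset.card_univ, Fintype.card_fin, nsmul_eq_mul, mul_assoc]

theorem HasMeanCov.ceil_pow_mul_integral_demandNorm_le [IsProbabilityMeasure P]
    (hX : HasMeanCov X 0 C P) {β τ : ℝ} (hβ : 1 ≤ β) {ℓ : ℕ}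
    (hC : ∀ v, (block C v).trace ≤ (β ^ (-(2 / 3) : ℝ)) ^ ℓ * τ) :
    ⌈β ^ ℓ⌉₊ * ∫ ω, demandNorm (fun v j => X ω (v, j)) ∂P ≤
      M * Fintype.card V * (2 * √τ) * (β ^ (2 / 3 : ℝ)) ^ ℓ :=
  calc _ ≤ ⌈β ^ ℓ⌉₊ * (M * Fintype.card V * √((β ^ (-(2 / 3) : ℝ)) ^ ℓ * τ)) := by
        gcongr
        exact hX.integral_demandNorm_le hC
    _ = M * Fintype.card V * (⌈β ^ ℓ⌉₊ * √((β ^ (-(2 / 3) : ℝ)) ^ ℓ * τ)) := by ring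
    _ ≤ M * Fintype.card V * (2 * √τ * (β ^ (2 / 3 : ℝ)) ^ ℓ) := by
        gcongr ?_ * ?_
        exact ceil_pow_mul_sqrt_le hβ τ ℓ
    _ = _ := by ring

end Moments

section ExpectedMajorant

variable {Ω : Type*} [MeasurableSpace Ω] {P : Measure Ω} {V : Type*} [Fintype V] {M ρ κ : ℕ}
  {β : ℝ} {n : ℕ → ℕ} {est : Ω → ℕ → Demand V M} {Φ : Ω → Demand V M}

theorem integrable_regretMajorant (hΦ : Integrable (fun ω => demandNorm (Φ ω)) P)
    (hest : ∀ ℓ, Integrable (fun ω => demandNorm (Φ ω - est ω ℓ)) P) (L : ℕ) :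
    Integrable (fun ω => regretMajorant ρ κ β n (est ω) (Φ ω) L) P :=
  (hΦ.const_mul _).add (integrable_finsetSum _ fun ℓ _ => (hest (ℓ + 1)).const_mul _)

theorem integral_regretMajorant_le (hΦ : Integrable (fun ω => demandNorm (Φ ω)) P)
    (hest : ∀ ℓ, Integrable (fun ω => demandNorm (Φ ω - est ω ℓ)) P) {Q C₀ E : ℝ} (hQ : 1 < Q)
    (hE : 0 ≤ E) (hn : ∀ ℓ, n ℓ ≤ C₀ * Q ^ ℓ)
    (herr : ∀ ℓ, ⌈β ^ ℓ⌉₊ * ∫ ω, demandNorm (Φ ω - est ω ℓ) ∂P ≤ E * Q ^ ℓ) (L : ℕ) :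
    ∫ ω, regretMajorant ρ κ β n (est ω) (Φ ω) L ∂P ≤
      ((ρ * C₀ + (Q - 1)⁻¹ * κ) * ∫ ω, demandNorm (Φ ω) ∂P + E * (Q * (Q - 1)⁻¹)) * Q ^ L := by
  have hΦ₀ : 0 ≤ ∫ ω, demandNorm (Φ ω) ∂P := integral_nonneg fun ω => demandNorm_nonneg _
  have hest' (ℓ : ℕ) : Integrable (fun ω => ⌈β ^ ℓ⌉₊ * demandNorm (Φ ω - est ω ℓ)) P :=
    (hest ℓ).const_mul _
  simp only [regretMajorant]
  rw [integral_add (hΦ.const_mul _) (integrable_finsetSum _ fun ℓ _ => hest' (ℓ + 1)),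
    integral_finsetSum _ fun ℓ _ => hest' (ℓ + 1)]
  simp only [integral_const_mul]
  calc _ ≤ (ρ * (C₀ * Q ^ L) + (Q - 1)⁻¹ * Q ^ L * κ) * ∫ ω, demandNorm (Φ ω) ∂P +
          ∑ ℓ ∈ Finset.range L, E * Q ^ (ℓ + 1) := by
        gcongr ?_ * _ + ∑ ℓ ∈ _, ?_
        · gcongr
          exacts [hn L, natCast_le_mul_pow hQ L]
        · exact herr _
    _ ≤ (ρ * (C₀ * Q ^ L) + (Q - 1)⁻¹ * Q ^ L * κ) * ∫ ω, demandNorm (Φ ω) ∂P +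
          E * (Q * (Q - 1)⁻¹ * Q ^ L) := by
        rw [← Finset.mul_sum]
        gcongr
        exact sum_range_pow_succ_le hQ L
    _ = _ := by ring

end ExpectedMajorant

theorem nullMeasurableSet_nonneg {Ω V : Type*} [MeasurableSpace Ω] {μ : Measure Ω} [Countable V]
    {M : ℕ} {Φ : Ω → Demand V M} (hΦ : AEMeasurable Φ μ) :
    NullMeasurableSet {ω | ∀ v j, 0 ≤ Φ ω v j} μ :=
  hΦ.nullMeasurableSet_preimage (measurableSet_Ici (a := (0 : Demand V M)))

section ExpectedRegret

variable {V : Type*} [Fintype V] [DecidableEq V] {N M : ℕ} {env : Environment V N M}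
  {tb : env.TieBreak} {Ω : Type*} [MeasurableSpace Ω] {μ : Measure Ω} {l u ρ : ℕ} {β : ℝ}
  {s : ℕ → V} {n : ℕ → ℕ} {est : Ω → ℕ → Demand V M} {Φ : Ω → Demand V M}

theorem integrable_cond_sum_regret (hβ : 1 < β) (hn : Monotone n) (hΦ : AEMeasurable Φ μ)
    (hΦ_int : Integrable (fun ω => demandNorm (Φ ω)) μ)
    (hest : ∀ ℓ, Integrable (fun ω => demandNorm (Φ ω - est ω ℓ)) μ)
    (run : (ω : Ω) → DSMLCRun tb l u ρ β s n (est ω))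
    (hrun : ∀ t x p, MeasurableSet {ω | (run ω).η t = x ∧ (run ω).P t = p}) (T : ℕ) :
    Integrable (fun ω => ∑ t ∈ Finset.Icc 1 T,
      Environment.regret tb (Φ ω) ((run ω).η t) ((run ω).P t))
      (cond μ {ω | ∀ v j, 0 ≤ Φ ω v j}) := by
  obtain ⟨C, hC⟩ := Environment.exists_isRegretConst tb
  obtain ⟨L, hL⟩ := pow_unbounded_of_one_lt (T : ℝ) hβ
  have hTL : (T : ℝ) ≤ β ^ (L + 1) := hL.le.trans (pow_le_pow_right₀ hβ.le L.le_succ)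
  exact integrable_cond_of_abs_le (nullMeasurableSet_nonneg hΦ)
    (Finset.aemeasurable_fun_sum _ fun t _ => Environment.aemeasurable_regret tb hΦ (hrun t))
    ((integrable_regretMajorant hΦ_int hest (L + 1)).const_mul C)
    fun ω hω => (run ω).abs_sum_regret_le hC hω hn L.succ_ne_zero hTL

theorem abs_integral_cond_sum_regret_le {C : ℝ} (hC : Environment.IsRegretConst tb C)
    (hn : Monotone n) (hΦ : AEMeasurable Φ μ) (hΦ_int : Integrable (fun ω => demandNorm (Φ ω)) μ)
    (hest : ∀ ℓ, Integrable (fun ω => demandNorm (Φ ω - est ω ℓ)) μ)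
    (run : (ω : Ω) → DSMLCRun tb l u ρ β s n (est ω)) {T L : ℕ} (hL : L ≠ 0) (hT : T ≤ β ^ L) :
    |∫ ω, ∑ t ∈ Finset.Icc 1 T, Environment.regret tb (Φ ω) ((run ω).η t) ((run ω).P t)
      ∂(cond μ {ω | ∀ v j, 0 ≤ Φ ω v j})| ≤
      (μ {ω | ∀ v j, 0 ≤ Φ ω v j})⁻¹.toReal *
        (C * ∫ ω, regretMajorant ρ (settlingTime V N u) β n (est ω) (Φ ω) L ∂μ) := by
  rw [← integral_const_mul]
  exact abs_integral_cond_le (nullMeasurableSet_nonneg hΦ)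
    ((integrable_regretMajorant hΦ_int hest L).const_mul C)
    (fun ω => mul_nonneg hC.nonneg (regretMajorant_nonneg _ _ _ _ _ _ _))
    fun ω hω => (run ω).abs_sum_regret_le hC hω hn hL hT

theorem isBigO_integral_cond_sum_regret {C₀ E : ℝ} (hβ : 1 < β) (hn : Monotone n)
    (hn_le : ∀ ℓ, n ℓ ≤ C₀ * (β ^ (2 / 3 : ℝ)) ^ ℓ) (hΦ : AEMeasurable Φ μ)
    (hΦ_int : Integrable (fun ω => demandNorm (Φ ω)) μ)
    (hest : ∀ ℓ, Integrable (fun ω => demandNorm (Φ ω - est ω ℓ)) μ) (hE : 0 ≤ E)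
    (hest_le : ∀ ℓ, ⌈β ^ ℓ⌉₊ * ∫ ω, demandNorm (Φ ω - est ω ℓ) ∂μ ≤ E * (β ^ (2 / 3 : ℝ)) ^ ℓ)
    (run : (ω : Ω) → DSMLCRun tb l u ρ β s n (est ω)) :
    (fun T : ℕ => ∫ ω, ∑ t ∈ Finset.Icc 1 T,
      Environment.regret tb (Φ ω) ((run ω).η t) ((run ω).P t)
      ∂(cond μ {ω | ∀ v j, 0 ≤ Φ ω v j})) =O[Filter.atTop] fun T : ℕ => (T : ℝ) ^ (2 / 3 : ℝ) := by
  obtain ⟨C, hC⟩ := Environment.exists_isRegretConst tb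
  have hQ : 1 < β ^ (2 / 3 : ℝ) := Real.one_lt_rpow hβ (by norm_num)
  obtain ⟨K, hK⟩ : ∃ K, ∀ L, ∫ ω, regretMajorant ρ (settlingTime V N u) β n (est ω) (Φ ω) L ∂μ ≤
      K * (β ^ (2 / 3 : ℝ)) ^ L :=
    ⟨_, integral_regretMajorant_le hΦ_int hest hQ hE hn_le hest_le⟩
  refine isBigO_rpow_of_abs_le_pow (C := (μ {ω | ∀ v j, 0 ≤ Φ ω v j})⁻¹.toReal * (C * K)) hβ
    (by norm_num) fun T L hL hT => ?_
  refine (abs_integral_cond_sum_regret_le hC hn hΦ hΦ_int hest run hL hT).trans ?_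
  rw [mul_assoc, mul_assoc C]
  gcongr
  exacts [hC.nonneg, hK L]

theorem isBigO_rpow_mul_log_pow {f : ℕ → ℝ} {p : ℝ}
    (hf : f =O[Filter.atTop] fun T : ℕ => (T : ℝ) ^ p) (k : ℕ) :
    f =O[Filter.atTop] fun T : ℕ => (T : ℝ) ^ p * Real.log T ^ k := by
  refine hf.trans (.of_bound 1 ?_)
  filter_upwards [Real.tendsto_log_atTop.comp tendsto_natCast_atTop_atTop
    |>.eventually_ge_atTop 1] with T hT
  rw [one_mul, norm_mul, norm_pow]
  exact le_mul_of_one_le_right (norm_nonneg _) (one_le_pow₀ (hT.trans (Real.le_norm_self _)))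

end ExpectedRegret

end MultitaskCoverage

theorem mainTheorem1_general {V : Type*} [Fintype V] [DecidableEq V] {N M : ℕ}
    {env : Environment V N M} {tb : env.TieBreak} {σ : ℝ} (hσ : σ ≠ 0) {μ₀ : V × Fin M → ℝ}
    {S : Matrix (V × Fin M) (V × Fin M) ℝ} {Ω : Type*} [MeasurableSpace Ω] {μ : Measure Ω}
    [IsProbabilityMeasure μ] {Φ : Ω → V × Fin M → ℝ} (hΦ : HasMeanCov Φ μ₀ S μ)
    {ε : ℕ → Ω → Fin M → ℝ}
    (hε : ∀ k, HasMeanCov (ε k) 0 (σ ^ 2 • (1 : Matrix (Fin M) (Fin M) ℝ)) μ)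
    (hεε : Pairwise fun k k' => crossCov (ε k) (ε k') μ = 0)
    (hΦε : ∀ k, crossCov Φ (ε k) μ = 0)
    {β α τ : ℝ} (hβ : 1 < β) (hα : α = β ^ (-(2 / 3) : ℝ)) (hτ : ∀ v, (block S v).trace ≤ τ)
    {s : ℕ → V} (hs : IsGreedy S σ s) {l u ρ : ℕ}
    (run : (ω : Ω) → DSMLCRun tb l u ρ β s (sampleTotal S σ s α τ)
      (fun ℓ v j => postMean μ₀ S σ s (fun m j' => Φ ω (s m, j') + ε m ω j')
        (sampleTotal S σ s α τ ℓ) (v, j)))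
    (hrun : ∀ t x p, MeasurableSet {ω | (run ω).η t = x ∧ (run ω).P t = p}) :
    (∀ T : ℕ, Integrable
      (fun ω => ∑ t ∈ Finset.Icc 1 T, Environment.regret tb
        (fun v j => Φ ω (v, j)) ((run ω).η t) ((run ω).P t))
      (cond μ {ω | ∀ v j, 0 ≤ Φ ω (v, j)})) ∧
    (fun T : ℕ => ∫ ω, ∑ t ∈ Finset.Icc 1 T, Environment.regret tb
        (fun v j => Φ ω (v, j)) ((run ω).η t) ((run ω).P t)
      ∂(cond μ {ω | ∀ v j, 0 ≤ Φ ω (v, j)}))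
      =O[Filter.atTop] fun T : ℕ => (T : ℝ) ^ (2 / 3 : ℝ) := by
  have hβ₀ : 0 < β := one_pos.trans hβ
  have hα₀ : 0 < α := hα ▸ Real.rpow_pos_of_pos hβ₀ _
  have hα₁ : α ≤ 1 := hα ▸ Real.rpow_le_one_of_one_le_of_nonpos hβ.le (by norm_num)
  have hαinv : α⁻¹ = β ^ (2 / 3 : ℝ) := by rw [hα, Real.rpow_neg hβ₀.le, inv_inv]
  have hS := hΦ.posSemidef
  have hpost (ℓ : ℕ) := eventually_trace_block_postCov_le_of_isGreedy hS hσ hs hτ (pow_pos hα₀ ℓ)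
  have hn := sampleTotal_mono hpost
  have hn_le (ℓ : ℕ) := hαinv ▸ inv_pow α ℓ ▸ sampleTotal_le_of_isGreedy hS hσ hs hτ hα₀ hα₁ ℓ
  have herr (ℓ : ℕ) := hasMeanCov_sub_postMean hσ hΦ hε hεε hΦε s (sampleTotal S σ s α τ ℓ)
  have herr_trace (ℓ : ℕ) := trace_block_postCov_sampleTotal_le hpost hτ ℓ
  have hΦ_meas : AEMeasurable (fun ω v j => Φ ω (v, j)) μ :=
    aemeasurable_pi_lambda _ fun v => aemeasurable_pi_lambda _ fun j => (hΦ.memLp _).aemeasurable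
  exact ⟨integrable_cond_sum_regret hβ hn hΦ_meas hΦ.integrable_demandNorm
      (fun ℓ => (herr ℓ).integrable_demandNorm) run hrun,
    isBigO_integral_cond_sum_regret hβ hn hn_le hΦ_meas hΦ.integrable_demandNorm
      (fun ℓ => (herr ℓ).integrable_demandNorm)
      (E := M * Fintype.card V * (2 * √τ)) (by positivity)
      (fun ℓ => (herr ℓ).ceil_pow_mul_integral_demandNorm_le hβ.le (hα ▸ herr_trace ℓ)) run⟩

theorem mainTheorem1
    {V : Type*} [Fintype V] [DecidableEq V] {N M : ℕ} [NeZero N]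
    (env : Environment V N M) (tb : env.TieBreak)
    -- squared-exponential prior, positive semidefinite inter-task covariance
    (D : Set (EuclideanSpace ℝ (Fin 2))) (hD_convex : Convex ℝ D) (hD_compact : IsCompact D)
    (pos : V → EuclideanSpace ℝ (Fin 2)) (hpos : ∀ v, pos v ∈ D)
    (σv len σ : ℝ) (hσv : 0 < σv) (hlen : 0 < len) (hσ : 0 < σ)
    (K : Matrix (Fin M) (Fin M) ℝ) (hK : K.PosSemidef)
    (μ₀ : EuclideanSpace ℝ (V × Fin M))
    (S : Matrix (V × Fin M) (V × Fin M) ℝ)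
    (hS : S = Matrix.kronecker (seKernel pos σv len) K)
    -- demand and observation noise
    {Ω : Type*} [MeasurableSpace Ω] (μ : Measure Ω)
    [IsProbabilityMeasure μ]
    (Φ : Ω → EuclideanSpace ℝ (V × Fin M))
    (hΦ : HasLaw Φ (multivariateGaussian μ₀ S) μ)
    (ε : ℕ → Ω → EuclideanSpace ℝ (Fin M))
    (hε : ∀ k, HasLaw (ε k)
      (multivariateGaussian 0 (σ ^ 2 • (1 : Matrix (Fin M) (Fin M) ℝ))) μ)
    (hε_indep : iIndepFun ε μ)
    (hΦε_indep : IndepFun Φ (fun ω k => ε k ω) μ)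
    -- parameters of the algorithm
    (β α τ : ℝ) (hβ : 1 < β) (hα : α = β ^ (-(2 / 3) : ℝ))
    (hτ : ∀ v, (block S v).trace ≤ τ)
    (s : ℕ → V) (hs : IsGreedy S σ s)
    (l u ρ : ℕ)
    -- a run of the algorithm for every outcome
    (run : (ω : Ω) → DSMLCRun tb l u ρ β s
      (sampleTotal S σ s α τ)
      (fun ℓ v j => postMean (fun p => μ₀ p) S σ s
        (fun m j' => Φ ω (s m, j') + ε m ω j')
        (sampleTotal S σ s α τ ℓ) (v, j)))
    (hrun : ∀ t x p, MeasurableSet {ω | (run ω).η t = x ∧ (run ω).P t = p}) :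
    (∀ T : ℕ, Integrable
      (fun ω => ∑ t ∈ Finset.Icc 1 T, Environment.regret tb
        (fun v j => Φ ω (v, j)) ((run ω).η t) ((run ω).P t))
      (cond μ {ω | ∀ v j, 0 ≤ Φ ω (v, j)})) ∧
    (fun T : ℕ => ∫ ω, ∑ t ∈ Finset.Icc 1 T, Environment.regret tb
        (fun v j => Φ ω (v, j)) ((run ω).η t) ((run ω).P t)
      ∂(cond μ {ω | ∀ v j, 0 ≤ Φ ω (v, j)}))
      =O[Filter.atTop] fun T : ℕ => (T : ℝ) ^ (2 / 3 : ℝ) * Real.log T ^ 3 := by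
  have hS_psd : S.PosSemidef := hS ▸ (posSemidef_seKernel pos σv hlen.ne').kronecker hK
  have hnoise : (σ ^ 2 • (1 : Matrix (Fin M) (Fin M) ℝ)).PosSemidef :=
    Matrix.PosSemidef.one.smul (sq_nonneg σ)
  have hΦ_cov := hasMeanCov_of_hasLaw_multivariateGaussian hS_psd hΦ
  have hε_cov (k : ℕ) := hasMeanCov_of_hasLaw_multivariateGaussian hnoise (hε k)
  have hεε : Pairwise fun k k' => crossCov (fun ω j => ε k ω j) (fun ω j => ε k' ω j) μ = 0 :=
    fun k k' hkk' => crossCov_eq_zero_of_indepFun (hε_cov k).memLp (hε_cov k').memLp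
      ((hε_indep.indepFun hkk').comp (WithLp.measurable_ofLp 2 _) (WithLp.measurable_ofLp 2 _))
  have hΦε (k : ℕ) : crossCov (fun ω p => Φ ω p) (fun ω j => ε k ω j) μ = 0 :=
    crossCov_eq_zero_of_indepFun hΦ_cov.memLp (hε_cov k).memLp
      (hΦε_indep.comp (WithLp.measurable_ofLp 2 _)
        ((WithLp.measurable_ofLp 2 _).comp (measurable_pi_apply k)))
  obtain ⟨hint, hbigO⟩ :=
    mainTheorem1_general hσ.ne' hΦ_cov hε_cov hεε hΦε hβ hα hτ hs run hrun
  exact ⟨hint, isBigO_rpow_mul_log_pow hbigO 3⟩
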